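/- Let $E$ be a locally compact complete separable metric space and $\mu$ a $\sigma$-finite Borel measure on $E$; call a subset of $E$ bounded if it is relatively compact. An operator $K$ on $L_2(E,\mu)$ (complex-valued functions) is locally of trace class if $\chi_BK\chi_B$ is of trace class for every bounded Borel set $B$. A configuration on $E$ is a collection of points (with multiplicities) without accumulation points in $E$; $\mathrm{Conf}(E)$ is the space of configurations, with the $\sigma$-algebra generated by the numbers of points in bounded Borel sets. A probability measure $\mathbb P$ on $\mathrm{Conf}(E)$ is the determinantal measure $\mathbb P_K$ induced by a locally trace class operator $K$ if, for every bounded measurable $g:E\to\mathbb C$ such that $g-1$ is supported in a bounded Borel set $B$, the functional $\Psi_g(X)=\prod_{x\in X}g(x)$ is $\mathbb P$-integrable and $\mathbb E_{\mathbb P}\Psi_g=\det(1+(g-1)K\chi_B)$ (Fredholm determinant). For a Borel function $f\ge 0$ let $\mathrm{Conf}_f(E)=\{X:\sum_{x\in X}f(x)<\infty\}$ and $\sigma_f:\mathrm{Conf}_f(E)\to\mathcal M_{\rm fin}(E)$, $\sigma_f(X)=\sum_{x\in X}f(x)\delta_x$, where $\mathcal M_{\rm fin}(\cdot)$ denotes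 the space of finite Borel measures with the weak topology; a family is precompact if its closure is compact. The angle $\angle(v,M)\in[0,\pi/2]$ between a nonzero vector $v$ and a closed subspace $M$ is the infimum of $\arccos\frac{|\langle v,w\rangle|}{\|v\|\,\|w\|}$ over nonzero $w\in M$ (and $\pi/2$ if $M=0$). Let $f$ be a bounded nonnegative continuous function on $E$. Let $(\Pi_\alpha)$ be a family of locally trace class orthogonal projections in $L_2(E,\mu)$, with ranges $L_\alpha$, such that $$\sup_\alpha \operatorname{tr}\sqrt f\,\Pi_\alpha\sqrt f<+\infty$$ and such that for every $\varepsilon>0$ there is a bounded Borel set $B_\varepsilon\subset E$ with $$\sup_\alpha \operatorname{tr}\chi_{E\setminus B_\varepsilon}\sqrt f\,\Pi_\alpha\sqrt f\,\chi_{E\setminus B_\varepsilon}<\varepsilon .$$ (a) For every $\alpha$ let $v_\alpha\in L_2(E,\mu)$ be orthogonal to $L_\alpha$, with $\inf_\alpha\|v_\alpha\|>0$, and suppose that the family of measures $f|v_\alpha|^2\mu$ is precompact in $\mathcal M_{\rm fin}(E)$. Let $\Pi^{v}_\alpha$ be the orthogonal projection onto $L_\alpha\oplus\mathbb Cv_\alpha$.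 Then the operators $\Pi^v_\alpha$ are locally of trace class, the pushforwards $(\sigma_f)_*\mathbb P_{\Pi^v_\alpha}$ are well defined (that is, $\mathbb P_{\Pi^v_\alpha}(\mathrm{Conf}_f(E))=1$ and $\sigma_f$ is $\mathbb P_{\Pi^v_\alpha}$-measurable), and the family $\{(\sigma_f)_*\mathbb P_{\Pi^v_\alpha}\}$ is weakly precompact in $\mathcal M_{\rm fin}(\mathcal M_{\rm fin}(E))$. (b) Let $m$ be a nonnegative integer and for every $\alpha$ let $v^{(1)}_\alpha,\dots,v^{(m)}_\alpha\in L_2(E,\mu)$ be unit vectors. Suppose that the family of measures $f|v^{(k)}_\alpha|^2\mu$, over all $\alpha$ and $k$, is precompact in $\mathcal M_{\rm fin}(E)$, and that there is $\delta>0$ such that for all $k=1,\dots,m$ and all $\alpha$ $$\angle\bigl(v^{(k)}_\alpha,\ L_\alpha\oplus\mathbb Cv^{(1)}_\alpha\oplus\dots\oplus\mathbb Cv^{(k-1)}_\alpha\bigr)\ge\delta .$$ Let $\Pi^{v,m}_\alpha$ be the orthogonal projection onto $L_\alpha\oplus\mathbb Cv^{(1)}_\alpha\oplus\dots\oplus\mathbb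 Cv^{(m)}_\alpha$. Then the operators $\Pi^{v,m}_\alpha$ are locally of trace class, the pushforwards $(\sigma_f)_*\mathbb P_{\Pi^{v,m}_\alpha}$ are well defined, and the family $\{(\sigma_f)_*\mathbb P_{\Pi^{v,m}_\alpha}\}$ is weakly precompact in $\mathcal M_{\rm fin}(\mathcal M_{\rm fin}(E))$. -/

import Mathlib

open MeasureTheory Set Filter Topology
open scoped ENNReal NNReal BoundedContinuousFunction InnerProductSpace

noncomputable section

namespace DetProc

/-! ### Trace class operators and Fredholm determinants on a complex Hilbert space -/

section Hilbert

variable {H : Type*} [NormedAddCommGroup H] [InnerProductSpace ℂ H]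

/-- The index set of a fixed orthonormal basis of `H`. -/
def basisIndex (H : Type*) [NormedAddCommGroup H] [InnerProductSpace ℂ H] [CompleteSpace H] :
    Set H :=
  (exists_hilbertBasis ℂ H).choose

/-- A fixed orthonormal basis of `H`. The trace of a positive operator, the trace class and the
Fredholm determinant defined below do not depend on it. -/
def basis (H : Type*) [NormedAddCommGroup H] [InnerProductSpace ℂ H] [CompleteSpace H] :
    HilbertBasis (basisIndex H) ℂ H :=
  (exists_hilbertBasis ℂ H).choose_spec.choose

/-- The trace `∑ ⟨eᵢ, T eᵢ⟩ ∈ [0, ∞]` of a positive operator `T`. -/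
def posTrace [CompleteSpace H] (T : H →L[ℂ] H) : ℝ≥0∞ :=
  ∑' i : basisIndex H, ENNReal.ofReal (⟪basis H i, T (basis H i)⟫_ℂ).re

/-- `T` is of trace class: `tr |T| < ∞`, where `|T| = (T* T)^(1/2)`. -/
def IsTraceClass [CompleteSpace H] (T : H →L[ℂ] H) : Prop :=
  posTrace (CFC.abs T) < ∞

open Classical in
/-- The Fredholm determinant `det (1 + A) = ∑ₙ tr (Λⁿ A)` of a trace class operator `A`.
The vectors `e_{i₁} ∧ ⋯ ∧ e_{iₙ}`, one for every `n`-element set of indices, form an orthonormal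
basis of the `n`-th exterior power, so that `tr (Λⁿ A)` is the sum of the `n × n` principal minors
of the matrix of `A`; for `A` of trace class the sum over all finite sets is absolutely
convergent. -/
def fredholmDet [CompleteSpace H] (A : H →L[ℂ] H) : ℂ :=
  ∑' S : Finset (basisIndex H),
    Matrix.det (Matrix.of fun i j : S => ⟪basis H i.1, A (basis H j.1)⟫_ℂ)

/-- The angle in `[0, π/2]` between a nonzero vector `v` and a subspace `M`: the infimum of the
angles `arccos (|⟨v, w⟩| / (‖v‖ ‖w‖))` over the nonzero vectors `w` of `M`. The value `π/2`, which
is an upper bound of all these angles, is inserted only to have angle `π/2` when `M = 0`. -/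
def vectorAngle (v : H) (M : Submodule ℂ H) : ℝ :=
  sInf (insert (Real.pi / 2)
    {θ : ℝ | ∃ w ∈ M, w ≠ 0 ∧ θ = Real.arccos (‖⟪v, w⟫_ℂ‖ / (‖v‖ * ‖w‖))})

/-- The orthogonal projection onto the closed subspace `M` (for a subspace that is not closed,
the projection onto its closure). -/
def orthProj [CompleteSpace H] (M : Submodule ℂ H) : H →L[ℂ] H :=
  M.topologicalClosure.starProjection

/-- A closed subspace plus a finite-dimensional one is closed; hence `orthProj` is the projection
onto the subspace itself for all the subspaces `L ⊕ ℂ v₁ ⊕ ⋯ ⊕ ℂ vₘ`. -/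
theorem isClosed_sup_span (L : Submodule ℂ H) (hL : IsClosed (L : Set H)) {s : Set H}
    (hs : s.Finite) : IsClosed ((L ⊔ Submodule.span ℂ s : Submodule ℂ H) : Set H) := by
  have := FiniteDimensional.span_of_finite ℂ hs
  exact Submodule.isClosed_sup_finiteDimensional _ _ hL

end Hilbert

/-! ### Operators in `L₂(E, μ)` -/

section Operators

variable {E : Type*} [MeasurableSpace E]

/-- The space `L₂(E, μ)` of complex-valued functions. -/
abbrev L2 (μ : Measure E) := Lp ℂ 2 μ

open Classical in
/-- The operator of multiplication by an (essentially) bounded measurable function `g`. -/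
def mulOp (μ : Measure E) (g : E → ℂ) : L2 μ →L[ℂ] L2 μ :=
  if hg : MemLp g ∞ μ then
    (ContinuousLinearMap.mul ℂ ℂ).holderL μ ∞ 2 2 (hg.toLp g)
  else 0

/-- The operator of multiplication by the indicator function `χ_B`. -/
def indOp (μ : Measure E) (B : Set E) : L2 μ →L[ℂ] L2 μ :=
  mulOp μ (B.indicator fun _ => 1)

/-- The operator of multiplication by `√f`. -/
def sqrtOp (μ : Measure E) (f : E → ℝ≥0) : L2 μ →L[ℂ] L2 μ :=
  mulOp μ fun x => ((NNReal.sqrt (f x) : ℝ) : ℂ)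

variable [TopologicalSpace E]

/-- Bounded Borel sets of the locally compact space `E`: the Borel sets with compact closure. -/
def BoundedBorel (B : Set E) : Prop :=
  MeasurableSet B ∧ IsCompact (closure B)

/-- Locally trace class operators: `χ_B K χ_B` is of trace class for all bounded Borel `B`. -/
def LocallyTraceClass (μ : Measure E) (K : L2 μ →L[ℂ] L2 μ) : Prop :=
  ∀ B : Set E, BoundedBorel B → IsTraceClass (indOp μ B * K * indOp μ B)

/-- The finite measure `f |v|² μ`, where `f` is bounded, nonnegative and continuous and
`v ∈ L₂(E, μ)`. -/
def densityMeasure [OpensMeasurableSpace E] (μ : Measure E) (f : E →ᵇ ℝ≥0) (v : L2 μ) :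
    FiniteMeasure E :=
  ⟨μ.withDensity fun x => (f x : ℝ≥0∞) * ‖v x‖ₑ ^ 2, by
    refine isFiniteMeasure_withDensity ?_
    have hv : ∫⁻ x, ‖v x‖ₑ ^ 2 ∂μ < ∞ := by
      have h := eLpNorm_lt_top_iff_lintegral_rpow_enorm_lt_top (p := 2) (f := v) (μ := μ)
        (by norm_num) (by norm_num)
      simpa using h.1 (Lp.memLp v).2
    obtain ⟨C, hC⟩ : ∃ C : ℝ≥0, ∀ x, f x ≤ C :=
      ⟨nndist f 0, fun x => by
        have := f.dist_coe_le_dist (g := 0) x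
        simpa [NNReal.dist_eq, ← NNReal.coe_le_coe] using this⟩
    refine ne_of_lt (lt_of_le_of_lt (lintegral_mono (g := fun x => (C : ℝ≥0∞) * ‖v x‖ₑ ^ 2)
      fun x => ?_) ?_)
    · exact mul_le_mul_left (ENNReal.coe_le_coe.2 (hC x)) _
    · rw [lintegral_const_mul' _ _ ENNReal.coe_ne_top]
      exact ENNReal.mul_lt_top ENNReal.coe_lt_top hv⟩

end Operators

/-! ### Configurations and determinantal measures -/

section Configurations

variable {E : Type*} [TopologicalSpace E] [MeasurableSpace E]

/-- A configuration on `E`: a collection of particles without order and without accumulation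
points, given by the number `mult x` of particles at every point `x`. -/
structure Conf (E : Type*) [TopologicalSpace E] where
  /-- The number of particles at a point. -/
  mult : E → ℕ
  /-- Every compact set contains only finitely many particles. -/
  finite_of_isCompact : ∀ C : Set E, IsCompact C → {x ∈ C | mult x ≠ 0}.Finite

/-- The number `#_B(X)` of particles of `X` in `B`. -/
def Conf.count (B : Set E) (X : Conf E) : ℝ≥0∞ :=
  ∑' x : B, (X.mult x : ℝ≥0∞)

/-- The Borel `σ`-algebra of the space of configurations, generated by the numbers of particles in
bounded Borel sets. -/
instance : MeasurableSpace (Conf E) :=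
  ⨆ (B : Set E) (_ : BoundedBorel B), MeasurableSpace.comap (Conf.count B) inferInstance

/-- The multiplicative functional `Ψ_g(X) = ∏_{x ∈ X} g(x)`; the product is finite if `g = 1`
outside a bounded set. -/
def Conf.mulFunctional (g : E → ℂ) (X : Conf E) : ℂ :=
  ∏ᶠ x, g x ^ X.mult x

/-- `P` is the determinantal measure induced by `K`: `K` is locally of trace class, and for every
bounded measurable `g` such that `g - 1` is supported in a bounded Borel set `B`, the functional
`Ψ_g` is integrable with expectation `det (1 + (g - 1) K χ_B)`. -/
def IsDeterminantal (μ : Measure E) (P : ProbabilityMeasure (Conf E)) (K : L2 μ →L[ℂ] L2 μ) :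
    Prop :=
  LocallyTraceClass μ K ∧
    ∀ (g : E → ℂ) (B : Set E), Measurable g → (∃ C : ℝ, ∀ x, ‖g x‖ ≤ C) → BoundedBorel B →
      (∀ x, x ∉ B → g x = 1) →
        Integrable (Conf.mulFunctional g) (P : Measure (Conf E)) ∧
          ∫ X, Conf.mulFunctional g X ∂(P : Measure (Conf E)) =
            fredholmDet (mulOp μ (fun x => g x - 1) * K * indOp μ B)

/-- The space of finite measures on `E` carries the Borel `σ`-algebra of the weak topology. -/
instance [OpensMeasurableSpace E] : MeasurableSpace (FiniteMeasure E) := borel _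

instance [OpensMeasurableSpace E] : BorelSpace (FiniteMeasure E) := ⟨rfl⟩

/-- The set of configurations `X` with `∑_{x ∈ X} f(x) < ∞`. -/
def confSummable (f : E → ℝ≥0) : Set (Conf E) :=
  {X | ∑' x, (X.mult x : ℝ≥0∞) * (f x : ℝ≥0∞) < ∞}

theorem isFiniteMeasure_sum_dirac (f : E → ℝ≥0) (X : Conf E) (hX : X ∈ confSummable f) :
    IsFiniteMeasure
      (Measure.sum fun x => ((X.mult x : ℝ≥0∞) * (f x : ℝ≥0∞)) • Measure.dirac x) := by
  refine ⟨?_⟩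
  rw [Measure.sum_apply _ MeasurableSet.univ]
  simpa [confSummable] using hX

open Classical in
/-- The map `σ_f(X) = ∑_{x ∈ X} f(x) δ_x` from the configurations with `∑_{x ∈ X} f(x) < ∞` to the
finite measures on `E` (extended by `0` to the other configurations). -/
def sigmaMap (f : E → ℝ≥0) (X : Conf E) : FiniteMeasure E :=
  if hX : X ∈ confSummable f then
    ⟨Measure.sum fun x => ((X.mult x : ℝ≥0∞) * (f x : ℝ≥0∞)) • Measure.dirac x,
      isFiniteMeasure_sum_dirac f X hX⟩
  else 0

/-- The determinantal measures `P_α` induced by the operators `K_α` have pushforwards `(σ_f)_* P_α`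
that are well defined and form a weakly precompact family in the space of finite measures on the
space of finite measures on `E`. Well defined means: `K_α` is locally of trace class, `P_α`-almost
every configuration lies in the domain of `σ_f`, and `σ_f` is `P_α`-measurable. -/
def PushforwardsPrecompact [OpensMeasurableSpace E] (μ : Measure E) (f : E → ℝ≥0) {ι : Type*}
    (K : ι → L2 μ →L[ℂ] L2 μ) : Prop :=
  (∀ α, LocallyTraceClass μ (K α)) ∧
    ∀ P : ι → ProbabilityMeasure (Conf E), (∀ α, IsDeterminantal μ (P α) (K α)) →
      (∀ α, ∀ᵐ X ∂(P α : Measure (Conf E)), X ∈ confSummable f) ∧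
      (∀ α, AEMeasurable (sigmaMap f) (P α : Measure (Conf E))) ∧
      IsCompact (closure (range fun α => (P α).toFiniteMeasure.map (sigmaMap f)))

end Configurations

end DetProc

end

open DetProc

/-! ### Hadamard's inequality -/

/-! For the orthogonal projection `Π` onto `M`, `B ↦ tr χ_B Π χ_B` is a measure (`traceMeasure M`).
The hypotheses on `Π_α` say that these measures, multiplied by `f`, have bounded mass and are
uniformly tight. The theorem follows because this property survives the perturbation and alone
implies precompactness.

Perturbation. With `u = v - Πv`, adjoining `v` adds to `Π` the projection onto `ℂu`. If `‖u‖⁻² ≤ C`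
and `‖Πv‖ ≤ 1`, the trace measure becomes at most `(1 + 2C)` times the old one plus `2C |v|² μ`
(`traceMeasure_sup_span_singleton_le`). Precompactness of the measures `f |v|² μ` makes them
uniformly tight (`uniformlyTight_of_isCompact_closure`), so tightness passes to the extension. In
(a) `u = v` has norm bounded below; in (b) an angle at least `δ` gives `‖u‖² ≥ 1 - cos² δ`, and one
inducts on the number of vectors.

Precompactness. The expected number of particles in `B` is at most `tr χ_B Π χ_B`
(`lintegral_count_le`): differentiate the expectation of `(1 - t)^{#_B}` at `t = 0`, with Hadamard's
inequality controlling the Fredholm determinant. Hence the mean of `σ_f(X)` is dominated by `f`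
times the trace measure. Markov's inequality puts `σ_f(X)`, with probability close to one uniformly
in `α`, in a compact set of finite measures, so the laws are tight and Prokhorov's theorem applies
(`isCompact_closure_range_map`). -/

theorem prod_le_one_of_sum_eq_card {n : Type*} [Fintype n] (x : n → ℝ) (hx : ∀ i, 0 ≤ x i)
    (hs : ∑ i, x i = Fintype.card n) : ∏ i, x i ≤ 1 := by
  calc ∏ i, x i ≤ ∏ i, Real.exp (x i - 1) :=
        Finset.prod_le_prod (fun i _ => hx i) fun i _ => by
          have := Real.add_one_le_exp (x i - 1); linarith
    _ = Real.exp (∑ i, (x i - 1)) := (Real.exp_sum _ _).symm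
    _ = 1 := by simp [Finset.sum_sub_distrib, hs]

open scoped ComplexOrder in
-- Normalizing the vectors leaves a positive semidefinite matrix with unit diagonal. Its eigenvalues
-- are nonnegative with sum `n`, so their product is at most one by the previous lemma.
theorem norm_det_gram_le {H : Type*} [NormedAddCommGroup H] [InnerProductSpace ℂ H]
    {n : Type*} [Fintype n] [DecidableEq n] (x : n → H) :
    ‖(Matrix.gram ℂ x).det‖ ≤ ∏ i, ‖x i‖ ^ 2 := by
  by_cases h0 : ∃ i, x i = 0
  · obtain ⟨i, hi⟩ := h0
    rw [Matrix.det_eq_zero_of_row_eq_zero i fun j => by simp [Matrix.gram, hi]]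
    simp only [norm_zero]
    positivity
  push Not at h0
  set y : n → H := fun i => ((‖x i‖⁻¹ : ℝ) : ℂ) • x i
  have hy : ∀ i, ‖y i‖ = 1 := fun i => by
    have := norm_ne_zero_iff.2 (h0 i)
    simp [y, norm_smul, this]
  have hxy : Matrix.gram ℂ x = Matrix.diagonal (fun i => (‖x i‖ : ℂ)) * Matrix.gram ℂ y *
      Matrix.diagonal (fun i => (‖x i‖ : ℂ)) := by
    ext i j
    have hi : (‖x i‖ : ℂ) ≠ 0 := by simpa using h0 i
    have hj : (‖x j‖ : ℂ) ≠ 0 := by simpa using h0 j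
    simp only [Matrix.mul_diagonal, Matrix.diagonal_mul, Matrix.gram_apply, y, inner_smul_left,
      inner_smul_right]
    simp only [Complex.ofReal_inv, map_inv₀, Complex.conj_ofReal]
    field_simp
  have hps := Matrix.posSemidef_gram ℂ y
  have hd : ‖(Matrix.gram ℂ y).det‖ ≤ 1 := by
    rw [hps.isHermitian.det_eq_prod_eigenvalues, norm_prod]
    have hn : ∀ i, ‖((hps.isHermitian.eigenvalues i : ℝ) : ℂ)‖ = hps.isHermitian.eigenvalues i :=
      fun i => by
        rw [Complex.norm_real, Real.norm_of_nonneg (hps.eigenvalues_nonneg i)]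
    refine (Finset.prod_congr rfl fun i _ => hn i).trans_le ?_
    refine prod_le_one_of_sum_eq_card _ (fun i => hps.eigenvalues_nonneg i) ?_
    have h1 := hps.isHermitian.trace_eq_sum_eigenvalues
    have h2 : (Matrix.gram ℂ y).trace = Fintype.card n := by
      simp [Matrix.trace, Matrix.gram_apply, inner_self_eq_norm_sq_to_K, hy]
    rw [h2] at h1
    have h3 := congrArg Complex.re h1
    simpa using h3.symm
  rw [hxy, Matrix.det_mul, Matrix.det_mul, Matrix.det_diagonal, norm_mul, norm_mul]
  simp only [norm_prod, Complex.norm_real, norm_norm]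
  calc _ ≤ (∏ i, ‖x i‖) * 1 * ∏ i, ‖x i‖ := by gcongr
    _ = _ := by rw [mul_one, ← Finset.prod_mul_distrib]; simp [sq]

/-! ### Hilbert–Schmidt sums -/

section Hilbert

variable {H : Type*} [NormedAddCommGroup H] [InnerProductSpace ℂ H] [CompleteSpace H]

theorem enorm_inner_symm {H : Type*} [NormedAddCommGroup H] [InnerProductSpace ℂ H] (x y : H) : ‖⟪x, y⟫_ℂ‖ₑ = ‖⟪y, x⟫_ℂ‖ₑ := by
  rw [← ofReal_norm, ← ofReal_norm, norm_inner_symm]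

/-- The squared Hilbert–Schmidt norm of `T`, with values in `[0, ∞]`. -/
noncomputable def hsSq (T : H →L[ℂ] H) : ℝ≥0∞ :=
  ∑' i : basisIndex H, ‖T (basis H i)‖ₑ ^ 2

theorem tsum_enorm_inner_basis_sq (x : H) :
    ∑' i : basisIndex H, ‖⟪basis H i, x⟫_ℂ‖ₑ ^ 2 = ‖x‖ₑ ^ 2 := by
  have h : HasSum (fun i => ‖⟪basis H i, x⟫_ℂ‖ ^ 2) (‖x‖ ^ 2) := by
    have h1 := (basis H).hasSum_inner_mul_inner x x
    have h2 := Complex.hasSum_re h1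
    convert h2 using 1
    · ext i
      rw [← inner_conj_symm x, ← Complex.normSq_eq_conj_mul_self, Complex.ofReal_re,
        Complex.normSq_eq_norm_sq]
    · rw [inner_self_eq_norm_sq_to_K]; norm_cast
  have h3 := ENNReal.ofReal_tsum_of_nonneg (fun i => by positivity) h.summable
  rw [h.tsum_eq] at h3
  simpa [ENNReal.ofReal_pow, ofReal_norm] using h3.symm

/-- Both sides are the sum of `|⟨e_i, T e_j⟩|²` over all pairs of indices. -/
theorem hsSq_adjoint (T : H →L[ℂ] H) : hsSq (ContinuousLinearMap.adjoint T) = hsSq T := by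
  unfold hsSq
  simp_rw [← tsum_enorm_inner_basis_sq (T _),
    ← tsum_enorm_inner_basis_sq (ContinuousLinearMap.adjoint T _)]
  rw [ENNReal.tsum_comm]
  refine tsum_congr fun i => tsum_congr fun j => ?_
  rw [ContinuousLinearMap.adjoint_inner_right, enorm_inner_symm]

theorem enorm_apply_sq_le_hsSq (T : H →L[ℂ] H) (w : H) :
    ‖T w‖ₑ ^ 2 ≤ hsSq T * ‖w‖ₑ ^ 2 := by
  rw [← tsum_enorm_inner_basis_sq, ← hsSq_adjoint, hsSq, ← ENNReal.tsum_mul_right]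
  refine ENNReal.tsum_le_tsum fun i => ?_
  rw [← ContinuousLinearMap.adjoint_inner_left, ← mul_pow]
  gcongr
  rw [← ofReal_norm, ← ofReal_norm, ← ofReal_norm, ← ENNReal.ofReal_mul (norm_nonneg _)]
  exact ENNReal.ofReal_le_ofReal (norm_inner_le_norm _ _)

theorem posTrace_adjoint_mul_self (T : H →L[ℂ] H) :
    posTrace (ContinuousLinearMap.adjoint T * T) = hsSq T := by
  unfold posTrace hsSq
  congr! 2 with i
  rw [mul_apply_eq_comp, ContinuousLinearMap.adjoint_inner_right,
    inner_self_eq_norm_sq_to_K]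
  rw [← RCLike.ofReal_pow, RCLike.ofReal_eq_complex_ofReal, Complex.ofReal_re, ENNReal.ofReal_pow (norm_nonneg _), ofReal_norm]

theorem isTraceClass_adjoint_mul_self_iff (T : H →L[ℂ] H) :
    IsTraceClass (ContinuousLinearMap.adjoint T * T) ↔ hsSq T < ∞ := by
  have h : 0 ≤ ContinuousLinearMap.adjoint T * T := star_mul_self_nonneg T
  rw [IsTraceClass, CFC.abs_of_nonneg _ h, posTrace_adjoint_mul_self]

theorem orthProj_mul_self (M : Submodule ℂ H) : orthProj M * orthProj M = orthProj M := by
  exact (Submodule.isIdempotentElem_starProjection _)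

theorem adjoint_orthProj (M : Submodule ℂ H) :
    ContinuousLinearMap.adjoint (orthProj M) = orthProj M :=
  (isSelfAdjoint_starProjection M.topologicalClosure).star_eq

/-- As `Π = Π² = Π*`, a compression of `Π` has the form `T* T` and is its own absolute value. Trace
class questions thus become questions about Hilbert–Schmidt norms. -/
theorem mul_orthProj_mul (M : Submodule ℂ H) (D : H →L[ℂ] H) :
    D * orthProj M * ContinuousLinearMap.adjoint D =
      ContinuousLinearMap.adjoint (orthProj M * ContinuousLinearMap.adjoint D) *
        (orthProj M * ContinuousLinearMap.adjoint D) := by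
  have : ContinuousLinearMap.adjoint (orthProj M * ContinuousLinearMap.adjoint D)
      = D * orthProj M := by
    change star (orthProj M * star D) = _
    rw [star_mul, star_star]
    congr 1
    exact adjoint_orthProj M
  rw [this, ← mul_assoc, mul_assoc D (orthProj M) (orthProj M), orthProj_mul_self]

theorem hsSq_orthProj_mul_adjoint (M : Submodule ℂ H) (D : H →L[ℂ] H) :
    hsSq (orthProj M * ContinuousLinearMap.adjoint D) = hsSq (D * orthProj M) := by
  rw [← hsSq_adjoint]
  congr 1
  change star (orthProj M * star D) = _
  rw [star_mul, star_star]
  congr 1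
  exact adjoint_orthProj M

theorem posTrace_mul_orthProj_mul (M : Submodule ℂ H) (D : H →L[ℂ] H) :
    posTrace (D * orthProj M * ContinuousLinearMap.adjoint D) = hsSq (D * orthProj M) := by
  rw [mul_orthProj_mul, posTrace_adjoint_mul_self, hsSq_orthProj_mul_adjoint]

theorem isTraceClass_mul_orthProj_mul_iff (M : Submodule ℂ H) (D : H →L[ℂ] H) :
    IsTraceClass (D * orthProj M * ContinuousLinearMap.adjoint D) ↔
      hsSq (D * orthProj M) < ∞ := by
  rw [mul_orthProj_mul, isTraceClass_adjoint_mul_self_iff, hsSq_orthProj_mul_adjoint]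

/-! ### A bound for Fredholm determinants -/

open Classical in
-- The principal minors of `T* T` are Gram determinants of the vectors `T e_i`, so Hadamard's
-- inequality bounds the minor of `z T* T` on `S` by `∏_{i ∈ S} a_i` with `a_i = |z| ‖T e_i‖²`.
-- Summing over `S` gives `∏ (1 + a_i) ≤ exp (∑ a_i)`.
theorem norm_fredholmDet_sub_one_le (T : H →L[ℂ] H) (hT : hsSq T ≠ ∞) (z : ℂ) :
    ‖fredholmDet (z • (ContinuousLinearMap.adjoint T * T)) - 1‖ ≤
      Real.exp (‖z‖ * (hsSq T).toReal) - 1 := by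
  set a : basisIndex H → ℝ := fun i => ‖z‖ * ‖T (basis H i)‖ ^ 2
  have ha : ∀ i, 0 ≤ a i := fun i => by positivity
  have hsq : HasSum (fun i => ‖T (basis H i)‖ ^ 2) (hsSq T).toReal := by
    have h1 := ENNReal.hasSum_toReal hT
    rw [← ENNReal.tsum_toReal_eq fun i => ENNReal.pow_ne_top enorm_ne_top] at h1
    simpa only [ENNReal.toReal_pow, toReal_enorm, hsSq] using h1
  have hsum : HasSum a (‖z‖ * (hsSq T).toReal) := hsq.mul_left _
  have hprod := summable_finsetProd_of_summable_nonneg ha hsum.summable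
  have hbound : ∀ S : Finset (basisIndex H), ‖Matrix.det (Matrix.of fun i j : S =>
      ⟪basis H i.1, (z • (ContinuousLinearMap.adjoint T * T)) (basis H j.1)⟫_ℂ)‖ ≤
        ∏ i ∈ S, a i := by
    intro S
    have : (Matrix.of fun i j : S =>
        ⟪basis H i.1, (z • (ContinuousLinearMap.adjoint T * T)) (basis H j.1)⟫_ℂ) =
        z • Matrix.gram ℂ fun i : S => T (basis H i.1) := by
      ext i j
      simp [Matrix.gram_apply, ContinuousLinearMap.adjoint_inner_right]
    rw [this, Matrix.det_smul, norm_mul, norm_pow]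
    calc _ ≤ ‖z‖ ^ Fintype.card S * ∏ i : S, ‖T (basis H i.1)‖ ^ 2 := by
          gcongr; exact norm_det_gram_le _
      _ = ∏ i : S, a i.1 := by simp [a, Finset.prod_mul_distrib]
      _ = _ := Finset.prod_coe_sort S a
  have hdet := Summable.of_norm_bounded hprod hbound
  have htot : ∑' S : Finset (basisIndex H), ∏ i ∈ S, a i ≤ Real.exp (‖z‖ * (hsSq T).toReal) := by
    rw [← tprod_one_add hprod]
    have hm : Multipliable fun i => 1 + a i := Real.multipliable_one_add_of_summable hsum.summable
    refine le_of_tendsto' hm.hasProd fun S => ?_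
    refine (Real.prod_one_add_le_exp_sum S ha).trans (Real.exp_le_exp.2 ?_)
    exact sum_le_hasSum S (fun i _ => ha i) hsum
  unfold fredholmDet
  -- The empty minor equals one: it cancels the subtracted one in the determinant and accounts for
  -- the `- 1` in the bound.
  rw [hdet.tsum_eq_add_tsum_ite ∅]
  rw [hprod.tsum_eq_add_tsum_ite ∅] at htot
  simp only [Finset.prod_empty] at htot
  have he : Matrix.det (Matrix.of fun i j : (∅ : Finset (basisIndex H)) =>
      ⟪basis H i.1, (z • (ContinuousLinearMap.adjoint T * T)) (basis H j.1)⟫_ℂ) = 1 :=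
    Matrix.det_isEmpty
  rw [he, add_sub_cancel_left]
  refine le_trans (tsum_of_norm_bounded (g := fun S => if S = ∅ then 0 else ∏ i ∈ S, a i) ?_ ?_)
    (le_sub_iff_add_le'.2 htot)
  · refine Summable.hasSum (Summable.of_nonneg_of_le (fun S => ?_) (fun S => ?_) hprod)
    · split_ifs
      · rfl
      · exact Finset.prod_nonneg fun i _ => ha i
    · split_ifs
      · exact Finset.prod_nonneg fun i _ => ha i
      · rfl
  · intro S
    split_ifs
    · simp
    · exact hbound S

end Hilbert

/-! ### Rank one extensions of projections -/

section RankOne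

variable {H : Type*} [NormedAddCommGroup H] [InnerProductSpace ℂ H] [CompleteSpace H]

theorem sub_orthProj_mem_orthogonal (M : Submodule ℂ H) (x : H) : x - orthProj M x ∈ Mᗮ := by
  rw [← Submodule.orthogonal_closure]
  exact Submodule.sub_starProjection_mem_orthogonal x

theorem orthProj_apply_mem (M : Submodule ℂ H) (x : H) : orthProj M x ∈ M.topologicalClosure :=
  Submodule.starProjection_apply_mem _ x

theorem inner_orthProj_eq_zero {M : Submodule ℂ H} {u : H} (hu : u ∈ Mᗮ) (x : H) :
    ⟪u, orthProj M x⟫_ℂ = 0 := by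
  rw [← Submodule.orthogonal_closure] at hu
  exact Submodule.inner_left_of_mem_orthogonal (orthProj_apply_mem M x) hu

theorem orthProj_sup_span_singleton_apply (M : Submodule ℂ H) (v x : H) :
    orthProj (M ⊔ Submodule.span ℂ {v}) x = orthProj M x +
      (⟪v - orthProj M v, x⟫_ℂ / ((‖v - orthProj M v‖ ^ 2 : ℝ) : ℂ)) • (v - orthProj M v) := by
  set u := v - orthProj M v with hu
  set c := ⟪u, x⟫_ℂ / ((‖u‖ ^ 2 : ℝ) : ℂ) with hc
  have huM : u ∈ Mᗮ := sub_orthProj_mem_orthogonal M v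
  have hle : M.topologicalClosure ≤ (M ⊔ Submodule.span ℂ {v}).topologicalClosure :=
    Submodule.topologicalClosure_mono le_sup_left
  refine Submodule.eq_starProjection_of_mem_orthogonal ?_ ?_
  · refine add_mem (hle (orthProj_apply_mem M x)) (Submodule.smul_mem _ _ (sub_mem ?_
      (hle (orthProj_apply_mem M v))))
    exact Submodule.le_topologicalClosure _
      (Submodule.mem_sup_right (Submodule.mem_span_singleton_self v))
  · rw [Submodule.orthogonal_closure, ← Submodule.inf_orthogonal]
    have hM : x - (orthProj M x + c • u) ∈ Mᗮ := by
      rw [← sub_sub]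
      exact sub_mem (sub_orthProj_mem_orthogonal M x) (Submodule.smul_mem _ _ huM)
    refine ⟨hM, ?_⟩
    refine Submodule.mem_orthogonal_singleton_iff_inner_right.2 ?_
    have hv : v = u + orthProj M v := by simp [hu]
    have h1 : ⟪orthProj M v, x - (orthProj M x + c • u)⟫_ℂ = 0 := by
      rw [← Submodule.orthogonal_closure] at hM
      exact Submodule.inner_right_of_mem_orthogonal (orthProj_apply_mem M v) hM
    rw [hv, inner_add_left, h1, add_zero, inner_sub_right, inner_add_right,
      inner_orthProj_eq_zero huM, inner_smul_right, inner_self_eq_norm_sq_to_K, zero_add, hc]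
    -- If `u = 0`, nothing is adjoined up to closure, and division by zero makes the correction term
    -- vanish.
    by_cases h0 : u = 0
    · simp [h0]
    · have : (‖u‖ : ℂ) ≠ 0 := by simpa using h0
      push_cast
      field_simp
      simp

theorem enorm_orthProj_sup_span_singleton_sq_le (M : Submodule ℂ H) (v x : H) (C : ℝ≥0)
    (hC : 1 ≤ C * ‖v - orthProj M v‖ ^ 2) :
    ‖orthProj (M ⊔ Submodule.span ℂ {v}) x‖ₑ ^ 2 ≤
      ‖orthProj M x‖ₑ ^ 2 + C * ‖⟪v - orthProj M v, x⟫_ℂ‖ₑ ^ 2 := by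
  rw [orthProj_sup_span_singleton_apply]
  set u := v - orthProj M v
  have huM : u ∈ Mᗮ := sub_orthProj_mem_orthogonal M v
  set c := ⟪u, x⟫_ℂ / ((‖u‖ ^ 2 : ℝ) : ℂ) with hc
  have h0 : 0 < ‖u‖ := by
    by_contra h
    have : ‖u‖ = 0 := le_antisymm (not_lt.1 h) (norm_nonneg _)
    rw [this] at hC
    norm_num at hC
  have horth : ⟪orthProj M x, c • u⟫_ℂ = 0 := by
    rw [inner_smul_right, ← inner_conj_symm, inner_orthProj_eq_zero huM]; simp
  have hpyth := norm_add_sq_eq_norm_sq_add_norm_sq_of_inner_eq_zero _ _ horth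
  have hcu : ‖c • u‖ * ‖c • u‖ ≤ C * ‖⟪u, x⟫_ℂ‖ ^ 2 := by
    rw [norm_smul, hc, norm_div, Complex.norm_real, Real.norm_of_nonneg (by positivity)]
    have : ‖⟪u, x⟫_ℂ‖ / ‖u‖ ^ 2 * ‖u‖ * (‖⟪u, x⟫_ℂ‖ / ‖u‖ ^ 2 * ‖u‖)
        = ‖⟪u, x⟫_ℂ‖ ^ 2 / ‖u‖ ^ 2 := by field_simp
    rw [this, div_le_iff₀ (by positivity)]
    nlinarith [mul_le_mul_of_nonneg_right hC (sq_nonneg ‖⟪u, x⟫_ℂ‖)]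
  have hreal : ‖orthProj M x + c • u‖ ^ 2 ≤ ‖orthProj M x‖ ^ 2 + C * ‖⟪u, x⟫_ℂ‖ ^ 2 := by
    nlinarith
  have := ENNReal.ofReal_le_ofReal hreal
  rw [ENNReal.ofReal_add (by positivity) (by positivity), ENNReal.ofReal_mul (by positivity)] at this
  simpa [ENNReal.ofReal_pow, ofReal_norm] using this

theorem enorm_sub_sq_le {F : Type*} [SeminormedAddCommGroup F] (x y : F) : ‖x - y‖ₑ ^ 2 ≤ 2 * ‖x‖ₑ ^ 2 + 2 * ‖y‖ₑ ^ 2 := by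
  have h : ‖x - y‖ ^ 2 ≤ 2 * ‖x‖ ^ 2 + 2 * ‖y‖ ^ 2 := by
    have := norm_sub_le x y
    nlinarith [sq_nonneg (‖x‖ - ‖y‖), norm_nonneg (x - y)]
  have := ENNReal.ofReal_le_ofReal h
  rw [ENNReal.ofReal_add (by positivity) (by positivity), ENNReal.ofReal_mul (by positivity),
    ENNReal.ofReal_mul (by positivity)] at this
  simpa [ENNReal.ofReal_pow, ofReal_norm] using this

/-- On the adjoint side the rank one term contributes `C ∑ |⟨u, D* e_i⟩|² = C ‖D u‖²`. It remains to
split `D u = D v - D Π v`. -/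
theorem hsSq_mul_orthProj_sup_span_singleton_le (M : Submodule ℂ H) (v : H) (D : H →L[ℂ] H)
    (C : ℝ≥0) (hC : 1 ≤ C * ‖v - orthProj M v‖ ^ 2) (hv : ‖orthProj M v‖ ≤ 1) :
    hsSq (D * orthProj (M ⊔ Submodule.span ℂ {v})) ≤
      hsSq (D * orthProj M) + C * (2 * ‖D v‖ₑ ^ 2 + 2 * hsSq (D * orthProj M)) := by
  have h1 : hsSq (D * orthProj (M ⊔ Submodule.span ℂ {v})) ≤
      hsSq (D * orthProj M) + C * ‖D (v - orthProj M v)‖ₑ ^ 2 := by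
    rw [← hsSq_orthProj_mul_adjoint, ← hsSq_orthProj_mul_adjoint,
      ← tsum_enorm_inner_basis_sq (D _), ← ENNReal.tsum_mul_left, hsSq, hsSq, ← ENNReal.tsum_add]
    refine ENNReal.tsum_le_tsum fun i => ?_
    refine (enorm_orthProj_sup_span_singleton_sq_le M v _ C hC).trans_eq ?_
    rw [enorm_inner_symm]
    exact congrArg (fun z : ℂ => ‖orthProj M (ContinuousLinearMap.adjoint D (basis H i))‖ₑ ^ 2 +
      C * ‖z‖ₑ ^ 2) (ContinuousLinearMap.adjoint_inner_left D (v - orthProj M v) (basis H i))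
  refine h1.trans ?_
  gcongr
  rw [map_sub]
  refine (enorm_sub_sq_le _ _).trans ?_
  gcongr
  -- Writing `Πv = Π(Πv)` lets the Hilbert–Schmidt norm of `D Π` absorb this term.
  have h2 : D (orthProj M v) = (D * orthProj M) (orthProj M v) := by
    have h3 := congrArg (fun T : H →L[ℂ] H => D (T v)) (orthProj_mul_self M)
    exact h3.symm
  rw [h2]
  refine (enorm_apply_sq_le_hsSq _ _).trans ?_
  have h4 : ‖orthProj M v‖ₑ ≤ 1 := by
    rw [← ofReal_norm]; exact ENNReal.ofReal_le_one.2 hv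
  calc _ ≤ hsSq (D * orthProj M) * 1 ^ 2 := by gcongr
    _ = _ := by simp

/-- For a unit vector `v`, the cosine of the angle between `v` and a nonzero `Πv` is `‖Πv‖`. Thus
`‖Πv‖ ≤ cos δ`, and Pythagoras gives the bound. -/
theorem one_sub_cos_sq_le_norm_sub_orthProj_sq {M : Submodule ℂ H}
    (hM : IsClosed (M : Set H)) {v : H} (hv : ‖v‖ = 1) {δ : ℝ} (hδ : 0 < δ)
    (h : δ ≤ vectorAngle v M) : 0 < 1 - Real.cos δ ^ 2 ∧
      1 - Real.cos δ ^ 2 ≤ ‖v - orthProj M v‖ ^ 2 := by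
  have hbdd : BddBelow (insert (Real.pi / 2)
      {θ : ℝ | ∃ w ∈ M, w ≠ 0 ∧ θ = Real.arccos (‖⟪v, w⟫_ℂ‖ / (‖v‖ * ‖w‖))}) := by
    refine ⟨0, ?_⟩
    rintro θ (rfl | ⟨w, -, -, rfl⟩)
    · positivity
    · exact Real.arccos_nonneg _
  -- The inserted value `π/2` forces `cos δ ≥ 0`, which also settles the case `Πv = 0`.
  have hpi : δ ≤ Real.pi / 2 := h.trans (csInf_le hbdd (mem_insert _ _))
  have hcos0 : 0 ≤ Real.cos δ := Real.cos_nonneg_of_neg_pi_div_two_le_of_le (by linarith) hpi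
  have hcos1 : Real.cos δ < 1 := by
    rw [← Real.cos_zero]
    exact Real.cos_lt_cos_of_nonneg_of_le_pi le_rfl (by linarith [Real.pi_pos]) hδ
  refine ⟨by nlinarith, ?_⟩
  set w := orthProj M v with hw
  have hwM : w ∈ M := by
    have := orthProj_apply_mem M v
    rwa [hM.submodule_topologicalClosure_eq] at this
  have hin : ⟪v, w⟫_ℂ = ((‖w‖ ^ 2 : ℝ) : ℂ) := by
    have h1 := inner_orthProj_eq_zero (sub_orthProj_mem_orthogonal M v) v
    rw [inner_sub_left, sub_eq_zero] at h1
    rw [hw, h1, inner_self_eq_norm_sq_to_K]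
    norm_cast
  have hsq : ‖v - w‖ ^ 2 = 1 - ‖w‖ ^ 2 := by
    rw [@norm_sub_sq ℂ, hin, hv]
    simp only [RCLike.re_eq_complex_re, Complex.ofReal_re]
    ring
  rw [hsq]
  have hwc : ‖w‖ ≤ Real.cos δ := by
    by_cases h0 : w = 0
    · simpa [h0] using hcos0
    · have h1 : δ ≤ Real.arccos ‖w‖ := by
        refine h.trans (csInf_le hbdd (mem_insert_of_mem _ ⟨w, hwM, h0, ?_⟩))
        rw [hin, hv, Complex.norm_real, Real.norm_of_nonneg (by positivity)]
        have := norm_ne_zero_iff.2 h0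
        field_simp
      have hw1 : ‖w‖ ≤ 1 := by nlinarith [sq_nonneg ‖v - w‖, norm_nonneg w]
      calc ‖w‖ = Real.cos (Real.arccos ‖w‖) :=
            (Real.cos_arccos (by linarith [norm_nonneg w]) hw1).symm
        _ ≤ Real.cos δ := Real.cos_le_cos_of_nonneg_of_le_pi hδ.le (Real.arccos_le_pi _) h1
  have := norm_nonneg w
  nlinarith

end RankOne

/-! ### Multiplication operators and the trace measure of a projection -/

section L2

variable {E : Type*} [MeasurableSpace E] {μ : Measure E}

theorem L2.enorm_sq_eq_lintegral (φ : L2 μ) : ‖φ‖ₑ ^ 2 = ∫⁻ x, ‖φ x‖ₑ ^ 2 ∂μ := by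
  rw [Lp.enorm_def, eLpNorm_eq_lintegral_rpow_enorm_toReal (by norm_num) (by norm_num),
    ← ENNReal.rpow_natCast, ← ENNReal.rpow_mul]
  simp

theorem coeFn_mulOp {g : E → ℂ} (hg : MemLp g ∞ μ) (φ : L2 μ) :
    mulOp μ g φ =ᵐ[μ] fun x => g x * φ x := by
  rw [mulOp, dif_pos hg, ContinuousLinearMap.holderL_apply_apply]
  refine (ContinuousLinearMap.coeFn_holder _ _ _).trans ?_
  filter_upwards [hg.coeFn_toLp] with x hx
  simp [hx]

theorem enorm_mulOp_sq {g : E → ℂ} (hg : MemLp g ∞ μ) (φ : L2 μ) :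
    ‖mulOp μ g φ‖ₑ ^ 2 = ∫⁻ x, ‖g x‖ₑ ^ 2 * ‖φ x‖ₑ ^ 2 ∂μ := by
  rw [L2.enorm_sq_eq_lintegral]
  refine lintegral_congr_ae ?_
  filter_upwards [coeFn_mulOp hg φ] with x hx
  rw [hx, enorm_mul, mul_pow]

theorem mulOp_mul_mulOp {g h : E → ℂ} (hg : MemLp g ∞ μ) (hh : MemLp h ∞ μ) :
    mulOp μ g * mulOp μ h = mulOp μ (fun x => g x * h x) := by
  have hgh : MemLp (fun x => g x * h x) ∞ μ := hh.mul hg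
  ext1 φ
  refine Lp.ext ?_
  filter_upwards [coeFn_mulOp hgh φ, coeFn_mulOp hg (mulOp μ h φ), coeFn_mulOp hh φ]
    with x h1 h2 h3
  rw [mul_apply_eq_comp, h2, h1, h3, mul_assoc]

theorem mulOp_const_mul {g : E → ℂ} (hg : MemLp g ∞ μ) (c : ℂ) :
    mulOp μ (fun x => c * g x) = c • mulOp μ g := by
  have hcg : MemLp (fun x => c * g x) ∞ μ := hg.const_mul c
  ext1 φ
  refine Lp.ext ?_
  filter_upwards [coeFn_mulOp hcg φ, coeFn_mulOp hg φ, Lp.coeFn_smul c (mulOp μ g φ)]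
    with x h1 h2 h3
  rw [smul_apply, h3, h1, Pi.smul_apply, h2, smul_eq_mul, mul_assoc]

theorem adjoint_mulOp {g : E → ℂ} (hg : MemLp g ∞ μ) (hr : ∀ x, starRingEnd ℂ (g x) = g x) :
    ContinuousLinearMap.adjoint (mulOp μ g) = mulOp μ g := by
  symm
  rw [ContinuousLinearMap.eq_adjoint_iff]
  intro φ ψ
  rw [MeasureTheory.L2.inner_def, MeasureTheory.L2.inner_def]
  refine integral_congr_ae ?_
  filter_upwards [coeFn_mulOp hg φ, coeFn_mulOp hg ψ] with x h1 h2
  rw [h1, h2]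
  simp only [RCLike.inner_apply, map_mul, hr]
  ring

theorem memLp_indicator_one {B : Set E} (hB : MeasurableSet B) :
    MemLp (B.indicator fun _ => (1 : ℂ)) ∞ μ :=
  memLp_top_of_bound (measurable_const.indicator hB).aestronglyMeasurable 1
    (Eventually.of_forall fun x => by
      by_cases h : x ∈ B <;> simp [h])

theorem adjoint_indOp {B : Set E} (hB : MeasurableSet B) :
    ContinuousLinearMap.adjoint (indOp μ B) = indOp μ B :=
  adjoint_mulOp (memLp_indicator_one hB) fun x => by
    by_cases h : x ∈ B <;> simp [h]

/-- The measure `B ↦ tr (χ_B Π χ_B)`, where `Π` is the orthogonal projection onto `M`. -/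
noncomputable def traceMeasure (M : Submodule ℂ (L2 μ)) : Measure E :=
  Measure.sum fun i : basisIndex (L2 μ) =>
    μ.withDensity fun x => ‖orthProj M (basis (L2 μ) i) x‖ₑ ^ 2

theorem lintegral_withDensity_enorm_sq (φ : L2 μ) {h : E → ℝ≥0∞} (hh : Measurable h) :
    ∫⁻ x, h x ∂(μ.withDensity fun x => ‖φ x‖ₑ ^ 2) = ∫⁻ x, h x * ‖φ x‖ₑ ^ 2 ∂μ := by
  rw [lintegral_withDensity_eq_lintegral_mul _ (by fun_prop) hh]
  simp [mul_comm]

/-- This turns weighted traces into integrals: `h = χ_B` gives local traces, `h = √f` and `h = χ_B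
√f` the traces in the hypotheses. -/
theorem hsSq_mulOp_mul_orthProj (M : Submodule ℂ (L2 μ)) {h : E → ℂ} (hm : Measurable h)
    (hh : MemLp h ∞ μ) :
    hsSq (mulOp μ h * orthProj M) = ∫⁻ x, ‖h x‖ₑ ^ 2 ∂traceMeasure M := by
  rw [traceMeasure, lintegral_sum_measure, hsSq]
  refine tsum_congr fun i => ?_
  rw [lintegral_withDensity_enorm_sq _ (by fun_prop)]
  exact enorm_mulOp_sq hh _

theorem hsSq_indOp_mul_orthProj (M : Submodule ℂ (L2 μ)) {B : Set E} (hB : MeasurableSet B) :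
    hsSq (indOp μ B * orthProj M) = traceMeasure M B := by
  rw [indOp, hsSq_mulOp_mul_orthProj M (measurable_const.indicator hB) (memLp_indicator_one hB),
    ← lintegral_indicator_one hB]
  refine lintegral_congr fun x => ?_
  by_cases h : x ∈ B <;> simp [h]

theorem locallyTraceClass_orthProj_iff [TopologicalSpace E] (M : Submodule ℂ (L2 μ)) :
    LocallyTraceClass μ (orthProj M) ↔ ∀ B, BoundedBorel B → traceMeasure M B < ∞ := by
  refine forall₂_congr fun B hB => ?_
  nth_rw 2 [← adjoint_indOp hB.1]
  rw [isTraceClass_mul_orthProj_mul_iff, hsSq_indOp_mul_orthProj M hB.1]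

theorem traceMeasure_sup_span_singleton_le (M : Submodule ℂ (L2 μ)) (v : L2 μ)
    (C : ℝ≥0) (hC : 1 ≤ C * ‖v - orthProj M v‖ ^ 2) (hv : ‖orthProj M v‖ ≤ 1) :
    traceMeasure (M ⊔ Submodule.span ℂ {v}) ≤
      ((1 + 2 * C : ℝ≥0) : ℝ≥0∞) • traceMeasure M +
        ((2 * C : ℝ≥0) : ℝ≥0∞) • μ.withDensity fun x => ‖v x‖ₑ ^ 2 := by
  refine Measure.le_iff.2 fun B hB => ?_
  have h1 := hsSq_mul_orthProj_sup_span_singleton_le M v (indOp μ B) C hC hv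
  rw [hsSq_indOp_mul_orthProj _ hB, hsSq_indOp_mul_orthProj _ hB] at h1
  have h2 : ‖indOp μ B v‖ₑ ^ 2 = (μ.withDensity fun x => ‖v x‖ₑ ^ 2) B := by
    rw [indOp, enorm_mulOp_sq (memLp_indicator_one hB), withDensity_apply _ hB,
      ← lintegral_indicator hB]
    refine lintegral_congr fun x => ?_
    by_cases h : x ∈ B <;> simp [h]
  rw [h2] at h1
  refine h1.trans_eq ?_
  simp only [Measure.coe_add, Measure.coe_smul, Pi.add_apply, Pi.smul_apply, smul_eq_mul]
  push_cast
  ring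

section

variable [TopologicalSpace E] [OpensMeasurableSpace E] (f : E →ᵇ ℝ≥0)

theorem boundedNN_apply_le {X : Type*} [TopologicalSpace X] (f : X →ᵇ ℝ≥0) (x : X) :
    f x ≤ nndist f 0 := by
  have := f.dist_coe_le_dist (g := 0) x
  simpa [NNReal.dist_eq, ← NNReal.coe_le_coe] using this

theorem measurable_boundedNN : Measurable f := f.continuous.measurable

theorem memLp_sqrt : MemLp (fun x => ((NNReal.sqrt (f x) : ℝ) : ℂ)) ∞ μ := by
  have hm : Measurable fun x => ((NNReal.sqrt (f x) : ℝ) : ℂ) := by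
    have := f.continuous.measurable
    fun_prop
  refine memLp_top_of_bound hm.aestronglyMeasurable (NNReal.sqrt (nndist f 0))
    (Eventually.of_forall fun x => ?_)
  rw [Complex.norm_real, Real.norm_of_nonneg (NNReal.coe_nonneg _), NNReal.coe_le_coe]
  exact NNReal.sqrt_le_sqrt.2 (boundedNN_apply_le f x)

theorem enorm_sqrt_sq (a : ℝ≥0) : ‖((NNReal.sqrt a : ℝ) : ℂ)‖ₑ ^ 2 = a := by
  rw [← ofReal_norm, Complex.norm_real, Real.norm_of_nonneg (NNReal.coe_nonneg _),
    ENNReal.ofReal_coe_nnreal, ← ENNReal.coe_pow, NNReal.sq_sqrt]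

theorem posTrace_sqrtOp (M : Submodule ℂ (L2 μ)) :
    posTrace (sqrtOp μ f * orthProj M * sqrtOp μ f) = ∫⁻ x, f x ∂traceMeasure M := by
  have hm : Measurable fun x => ((NNReal.sqrt (f x) : ℝ) : ℂ) := by
    have := f.continuous.measurable
    fun_prop
  have hadj : ContinuousLinearMap.adjoint (sqrtOp μ f) = sqrtOp μ f :=
    adjoint_mulOp (memLp_sqrt f) fun x => Complex.conj_ofReal _
  nth_rw 2 [← hadj]
  rw [posTrace_mul_orthProj_mul, sqrtOp, hsSq_mulOp_mul_orthProj M hm (memLp_sqrt f)]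
  simp_rw [enorm_sqrt_sq]

theorem posTrace_indOp_sqrtOp (M : Submodule ℂ (L2 μ)) {B : Set E} (hB : MeasurableSet B) :
    posTrace (indOp μ B * sqrtOp μ f * orthProj M * sqrtOp μ f * indOp μ B) =
      ∫⁻ x in B, f x ∂traceMeasure M := by
  have hm : Measurable fun x => ((NNReal.sqrt (f x) : ℝ) : ℂ) := by
    have := f.continuous.measurable
    fun_prop
  have hadj : ContinuousLinearMap.adjoint (sqrtOp μ f) = sqrtOp μ f :=
    adjoint_mulOp (memLp_sqrt f) fun x => Complex.conj_ofReal _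
  have hadj2 : ContinuousLinearMap.adjoint (indOp μ B * sqrtOp μ f) = sqrtOp μ f * indOp μ B := by
    change star (_ * _) = _
    rw [star_mul]
    exact congrArg₂ _ hadj (adjoint_indOp hB)
  rw [mul_assoc, ← hadj2, posTrace_mul_orthProj_mul, indOp, sqrtOp,
    mulOp_mul_mulOp (memLp_indicator_one hB) (memLp_sqrt f),
    hsSq_mulOp_mul_orthProj M (h := fun x => B.indicator (fun _ => 1) x * _)
      ((measurable_const.indicator hB).mul hm)
      ((memLp_sqrt f).mul (memLp_indicator_one hB)), ← lintegral_indicator hB]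
  refine lintegral_congr fun x => ?_
  by_cases h : x ∈ B
  · simp only [h, indicator_of_mem, one_mul]
    exact enorm_sqrt_sq _
  · simp [h]

end

end L2

/-! ### The intensity of a determinantal measure -/

section Intensity

variable {E : Type*} [TopologicalSpace E] [MeasurableSpace E]

/-- The measure `∑_{x ∈ X} δ_x`. -/
noncomputable def confMeasure (X : Conf E) : Measure E :=
  Measure.sum fun x => (X.mult x : ℝ≥0∞) • Measure.dirac x

theorem confMeasure_apply (X : Conf E) {A : Set E} (hA : MeasurableSet A) :
    confMeasure X A = Conf.count A X := by
  rw [confMeasure, Measure.sum_apply _ hA, Conf.count, tsum_subtype A fun x => (X.mult x : ℝ≥0∞)]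
  refine tsum_congr fun x => ?_
  by_cases h : x ∈ A <;> simp [hA, h]

theorem lintegral_confMeasure (X : Conf E) {h : E → ℝ≥0∞} (hh : Measurable h) :
    ∫⁻ x, h x ∂confMeasure X = ∑' x, (X.mult x : ℝ≥0∞) * h x := by
  rw [confMeasure, lintegral_sum_measure]
  refine tsum_congr fun x => ?_
  rw [lintegral_smul_measure, lintegral_dirac' _ hh, smul_eq_mul]

theorem measurable_count {B : Set E} (hB : BoundedBorel B) :
    Measurable (Conf.count B : Conf E → ℝ≥0∞) :=
  Measurable.mono (comap_measurable (Conf.count B))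
    (le_iSup₂_of_le (f := fun (B : Set E) (_ : BoundedBorel B) =>
      MeasurableSpace.comap (Conf.count B) inferInstance) B hB le_rfl) le_rfl

/-- The number `N` is chosen before `c` and `g`, so that it serves a whole sequence of test
functions at once. -/
theorem exists_count_eq_and_mulFunctional_eq [T2Space E] {B : Set E} (hB : BoundedBorel B)
    (X : Conf E) : ∃ N : ℕ, Conf.count B X = N ∧
      ∀ (c : ℂ) (g : E → ℂ), (∀ x ∈ B, g x = c) → (∀ x, x ∉ B → g x = 1) →
        Conf.mulFunctional g X = c ^ N := by
  classical
  set s : Finset E := ((X.finite_of_isCompact _ hB.2).subset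
    (show {x ∈ B | X.mult x ≠ 0} ⊆ _ from fun x hx => ⟨subset_closure hx.1, hx.2⟩)).toFinset
  have hs : ∀ x, x ∈ s ↔ x ∈ B ∧ X.mult x ≠ 0 := fun x => by simp [s]
  refine ⟨∑ x ∈ s, X.mult x, ?_, fun c g hg hg' => ?_⟩
  · rw [Conf.count, tsum_subtype B fun x => (X.mult x : ℝ≥0∞), tsum_eq_sum (s := s)]
    · push_cast
      exact Finset.sum_congr rfl fun x hx => indicator_of_mem ((hs x).1 hx).1 _
    · intro x hx
      by_cases h : x ∈ B
      · have : X.mult x = 0 := by_contra fun h0 => hx ((hs x).2 ⟨h, h0⟩)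
        simp [this]
      · simp [h]
  · rw [Conf.mulFunctional, finprod_eq_prod_of_mulSupport_subset (s := s),
      ← Finset.prod_pow_eq_pow_sum]
    · exact Finset.prod_congr rfl fun x hx => by rw [hg x ((hs x).1 hx).1]
    · intro x hx
      rw [Finset.mem_coe, hs]
      refine ⟨by_contra fun h => hx (by simp [hg' x h]), fun h => hx (by simp [h])⟩

/-- For `g = 1 - t χ_B` the functional is `(1 - t)^{#_B}`, and its difference quotient at `t = 0`
tends to `#_B`. The determinant bound controls the expected quotients; Fatou's lemma needs no prior
integrability of `#_B` and yields the inequality, which suffices. -/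
theorem lintegral_count_le [T2Space E] {μ : Measure E} {P : ProbabilityMeasure (Conf E)}
    {M : Submodule ℂ (L2 μ)} (hP : IsDeterminantal μ P (orthProj M)) {B : Set E}
    (hB : BoundedBorel B) :
    ∫⁻ X, Conf.count B X ∂(P : Measure (Conf E)) ≤ traceMeasure M B := by
  classical
  have hfin : traceMeasure M B < ∞ := (locallyTraceClass_orthProj_iff M).1 hP.1 B hB
  set T : ℝ := (traceMeasure M B).toReal with hT
  set t : ℕ → ℝ := fun n => 1 / ((n : ℝ) + 1)
  have ht0 : ∀ n, 0 < t n := fun n => by positivity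
  have ht : Tendsto t atTop (𝓝 0) := tendsto_one_div_add_atTop_nhds_zero_nat
  set g : ℕ → E → ℂ := fun n x => 1 - t n * B.indicator (fun _ => (1 : ℂ)) x
  have hgB : ∀ n, ∀ x ∈ B, g n x = ((1 - t n : ℝ) : ℂ) := fun n x hx => by simp [g, hx]
  have hgB' : ∀ n x, x ∉ B → g n x = 1 := fun n x hx => by simp [g, hx]
  have hgm : ∀ n, Measurable (g n) := fun n =>
    measurable_const.sub (measurable_const.mul (measurable_const.indicator hB.1))
  have hdet := fun n => hP.2 (g n) B (hgm n) ⟨‖((1 - t n : ℝ) : ℂ)‖ + 1, fun x => by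
    by_cases hx : x ∈ B
    · rw [hgB n x hx]; linarith
    · rw [hgB' n x hx, norm_one]; linarith [norm_nonneg ((1 - t n : ℝ) : ℂ)]⟩ hB (hgB' n)
  have hop : ∀ n, ‖fredholmDet (mulOp μ (fun x => g n x - 1) * orthProj M * indOp μ B) - 1‖ ≤
      Real.exp (t n * T) - 1 := fun n => by
    have h1 : (fun x => g n x - 1) = fun x => (-(t n : ℂ)) * B.indicator (fun _ => (1 : ℂ)) x := by
      ext x; simp [g]
    rw [h1, mulOp_const_mul (memLp_indicator_one hB.1), smul_mul_assoc, smul_mul_assoc]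
    change ‖fredholmDet (_ • (indOp μ B * _ * _)) - 1‖ ≤ _
    nth_rw 2 [← adjoint_indOp hB.1]
    rw [mul_orthProj_mul]
    have h2 : hsSq (orthProj M * ContinuousLinearMap.adjoint (indOp μ B)) = traceMeasure M B := by
      rw [hsSq_orthProj_mul_adjoint, hsSq_indOp_mul_orthProj _ hB.1]
    refine (norm_fredholmDet_sub_one_le _ (by rw [h2]; exact hfin.ne) _).trans_eq ?_
    rw [h2, norm_neg, Complex.norm_real, Real.norm_of_nonneg (ht0 n).le]
  choose N hN hΨ using exists_count_eq_and_mulFunctional_eq (E := E) hB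
  have hΨ' : ∀ n X, Conf.mulFunctional (g n) X = (((1 - t n) ^ N X : ℝ) : ℂ) := fun n X => by
    rw [hΨ X _ (g n) (hgB n) (hgB' n)]; push_cast; rfl
  set G : ℕ → Conf E → ℝ := fun n X => (1 - (1 - t n) ^ N X) / t n
  -- As a geometric sum, the quotient is visibly nonnegative and converges to `N X`.
  have hG : ∀ n X, G n X = ∑ k ∈ Finset.range (N X), (1 - t n) ^ k := fun n X => by
    have := mul_neg_geom_sum (1 - t n) (N X)
    simp only [G]
    rw [div_eq_iff (ht0 n).ne', ← this]
    ring
  have hint : ∀ n, Integrable (fun X => (1 - t n) ^ N X) (P : Measure (Conf E)) := fun n => by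
    have := (hdet n).1.re
    refine this.congr (Eventually.of_forall fun X => ?_)
    simp only [hΨ']
    exact Complex.ofReal_re _
  have hGint : ∀ n, Integrable (G n) (P : Measure (Conf E)) := fun n =>
    ((integrable_const _).sub (hint n)).div_const _
  have hG0 : ∀ n X, 0 ≤ G n X := fun n X => by
    have h1 : t n ≤ 1 := by
      simp only [t]
      rw [div_le_one (by positivity)]
      linarith [Nat.cast_nonneg (α := ℝ) n]
    rw [hG]
    exact Finset.sum_nonneg fun k _ => pow_nonneg (by linarith) _
  have hGle : ∀ n, ∫⁻ X, ENNReal.ofReal (G n X) ∂(P : Measure (Conf E)) ≤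
      ENNReal.ofReal (T * Real.exp (t n * T)) := fun n => by
    rw [← ofReal_integral_eq_lintegral_ofReal (hGint n) (Eventually.of_forall (hG0 n))]
    refine ENNReal.ofReal_le_ofReal ?_
    have h1 : ∫ X, G n X ∂(P : Measure (Conf E)) =
        (1 - ∫ X, (1 - t n) ^ N X ∂(P : Measure (Conf E))) / t n := by
      simp only [G]
      rw [integral_div, integral_sub (integrable_const _) (hint n)]
      simp
    have h2 := hop n
    rw [← (hdet n).2] at h2
    simp_rw [hΨ'] at h2
    rw [integral_complex_ofReal] at h2
    have h3 : 1 - ∫ X, (1 - t n) ^ N X ∂(P : Measure (Conf E)) ≤ Real.exp (t n * T) - 1 := by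
      refine le_trans ?_ h2
      rw [← Complex.ofReal_one, ← Complex.ofReal_sub, Complex.norm_real, Real.norm_eq_abs,
        abs_sub_comm]
      exact le_abs_self _
    -- The bound `e^x - 1 ≤ x e^x` exposes the factor `t n` that cancels the denominator.
    have h4 : Real.exp (t n * T) - 1 ≤ t n * T * Real.exp (t n * T) := by
      have h5 := Real.add_one_le_exp (-(t n * T))
      have h6 : Real.exp (-(t n * T)) * Real.exp (t n * T) = 1 := by
        rw [← Real.exp_add]; simp
      nlinarith [Real.exp_pos (t n * T)]
    rw [h1, div_le_iff₀ (ht0 n)]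
    calc _ ≤ _ := h3.trans h4
      _ = _ := by ring
  have hlim : ∀ X, Tendsto (fun n => ENNReal.ofReal (G n X)) atTop (𝓝 (Conf.count B X)) := by
    intro X
    rw [hN X, ← ENNReal.ofReal_natCast]
    refine ENNReal.tendsto_ofReal ?_
    simp_rw [hG]
    have h1 : Tendsto (fun n => ∑ k ∈ Finset.range (N X), (1 - t n) ^ k) atTop
        (𝓝 (∑ k ∈ Finset.range (N X), (1 - 0) ^ k)) :=
      tendsto_finsetSum _ fun k _ => (tendsto_const_nhds.sub ht).pow k
    simpa using h1
  calc ∫⁻ X, Conf.count B X ∂(P : Measure (Conf E))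
      = ∫⁻ X, liminf (fun n => ENNReal.ofReal (G n X)) atTop ∂(P : Measure (Conf E)) :=
        lintegral_congr fun X => (hlim X).liminf_eq.symm
    _ ≤ liminf (fun n => ∫⁻ X, ENNReal.ofReal (G n X) ∂(P : Measure (Conf E))) atTop :=
        lintegral_liminf_le' fun n => (hGint n).aemeasurable.ennreal_ofReal
    _ ≤ liminf (fun n => ENNReal.ofReal (T * Real.exp (t n * T))) atTop :=
        liminf_le_liminf (Eventually.of_forall hGle)
    _ = ENNReal.ofReal (T * Real.exp (0 * T)) := by
        refine (ENNReal.tendsto_ofReal ?_).liminf_eq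
        exact tendsto_const_nhds.mul ((Real.continuous_exp.tendsto _).comp (ht.mul_const T))
    _ = traceMeasure M B := by simp [hT, ENNReal.ofReal_toReal hfin.ne]

/-- Carries measurability and the intensity bound from bounded Borel sets to all Borel sets, even of
infinite measure. -/
theorem measure_eq_iSup_inter_compactCovering [SigmaCompactSpace E] (ν : Measure E) (A : Set E) :
    ν A = ⨆ n, ν (A ∩ compactCovering E n) := by
  have hmono : Monotone fun n => A ∩ compactCovering E n := fun _ _ h =>
    inter_subset_inter_right _ (compactCovering_subset E h)
  rw [← hmono.measure_iUnion, ← inter_iUnion, iUnion_compactCovering,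
    inter_univ]

variable [T2Space E] [SigmaCompactSpace E] [OpensMeasurableSpace E]

theorem boundedBorel_inter_compactCovering {A : Set E} (hA : MeasurableSet A) (n : ℕ) :
    BoundedBorel (A ∩ compactCovering E n) :=
  ⟨hA.inter (isCompact_compactCovering E n).isClosed.measurableSet,
    (isCompact_compactCovering E n).closure_of_subset inter_subset_right⟩

theorem measurable_confMeasure : Measurable (confMeasure : Conf E → Measure E) := by
  refine Measure.measurable_of_measurable_coe _ fun A hA => ?_
  simp_rw [measure_eq_iSup_inter_compactCovering _ A]
  refine Measurable.iSup fun n => ?_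
  have hB := boundedBorel_inter_compactCovering hA n
  simp_rw [confMeasure_apply _ hB.1]
  exact measurable_count hB

theorem bind_confMeasure_le {μ : Measure E} {P : ProbabilityMeasure (Conf E)}
    {M : Submodule ℂ (L2 μ)} (hP : IsDeterminantal μ P (orthProj M)) :
    (P : Measure (Conf E)).bind confMeasure ≤ traceMeasure M := by
  refine Measure.le_iff.2 fun A hA => ?_
  rw [measure_eq_iSup_inter_compactCovering _ A, measure_eq_iSup_inter_compactCovering _ A]
  refine iSup_mono fun n => ?_
  have hB := boundedBorel_inter_compactCovering hA n
  rw [Measure.bind_apply hB.1 measurable_confMeasure.aemeasurable]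
  simp_rw [confMeasure_apply _ hB.1]
  exact lintegral_count_le hP hB

theorem lintegral_lintegral_confMeasure_le {μ : Measure E} {P : ProbabilityMeasure (Conf E)}
    {M : Submodule ℂ (L2 μ)} (hP : IsDeterminantal μ P (orthProj M)) {h : E → ℝ≥0∞}
    (hh : Measurable h) :
    ∫⁻ X, ∫⁻ x, h x ∂confMeasure X ∂(P : Measure (Conf E)) ≤ ∫⁻ x, h x ∂traceMeasure M := by
  rw [← Measure.lintegral_bind measurable_confMeasure.aemeasurable hh.aemeasurable]
  exact lintegral_mono' (bind_confMeasure_le hP) le_rfl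

end Intensity

/-! ### Measurability of maps into the space of finite measures -/

section Borel

variable {E : Type*} [TopologicalSpace E] [SecondCountableTopology E]

/-- The maximum of finitely many multiples of indicator functions of basic open sets. -/
noncomputable def stepSup (F : Finset (TopologicalSpace.countableBasis E × ℚ)) (x : E) : ℝ≥0∞ :=
  ⨆ i ∈ F, (i.1 : Set E).indicator (fun _ => (Real.toNNReal i.2 : ℝ≥0∞)) x

theorem stepSup_mono {F G : Finset (TopologicalSpace.countableBasis E × ℚ)} (h : F ⊆ G) (x : E) :
    stepSup F x ≤ stepSup G x :=
  biSup_mono fun _ hi => h hi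

/-- Rational heights on basic open sets suffice to approximate `φ` from below, so countably many
step functions determine the integrals of all continuous `φ`. -/
theorem iSup_stepSup_eq {φ : E → ℝ≥0∞} (hφ : Continuous φ) (x : E) :
    ⨆ F : {F : Finset (TopologicalSpace.countableBasis E × ℚ) // ∀ y, stepSup F y ≤ φ y},
      stepSup F.1 x = φ x := by
  refine le_antisymm (iSup_le fun F => F.2 x) (le_of_forall_lt fun a ha => ?_)
  obtain ⟨q, -, haq, hq⟩ := ENNReal.lt_iff_exists_rat_btwn.1 ha
  have hopen : IsOpen {y | (Real.toNNReal q : ℝ≥0∞) < φ y} := isOpen_lt continuous_const hφ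
  obtain ⟨U, hU, hxU, hUs⟩ :=
    (TopologicalSpace.isBasis_countableBasis E).exists_subset_of_mem_open
      (show x ∈ {y | (Real.toNNReal q : ℝ≥0∞) < φ y} from hq) hopen
  refine haq.trans_le (le_iSup_of_le ⟨{(⟨U, hU⟩, q)}, fun y => ?_⟩ ?_)
  · by_cases hy : y ∈ U
    · simpa [stepSup, hy] using (hUs hy).le
    · simp [stepSup, hy]
  · simp [stepSup, hxU]

theorem directed_stepSup (φ : E → ℝ≥0∞) : Directed (fun x1 x2 => x1 ≤ x2) fun
    (F : {F : Finset (TopologicalSpace.countableBasis E × ℚ) // ∀ y, stepSup F y ≤ φ y})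
    (x : E) => stepSup F.1 x := by
  classical
  intro F G
  have hFG : ∀ y, stepSup (F.1 ∪ G.1) y ≤ φ y := fun y => by
    refine iSup₂_le fun i hi => ?_
    rcases Finset.mem_union.1 hi with h | h
    · exact (le_iSup₂_of_le i h le_rfl).trans (F.2 y)
    · exact (le_iSup₂_of_le i h le_rfl).trans (G.2 y)
  exact ⟨⟨F.1 ∪ G.1, hFG⟩, fun y => stepSup_mono Finset.subset_union_left y,
    fun y => stepSup_mono Finset.subset_union_right y⟩

variable [MeasurableSpace E] [OpensMeasurableSpace E]

theorem measurable_stepSup (F : Finset (TopologicalSpace.countableBasis E × ℚ)) :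
    Measurable (stepSup F) := by
  refine Measurable.biSup _ F.countable_toSet fun i _ => measurable_const.indicator ?_
  exact (TopologicalSpace.isOpen_of_mem_countableBasis i.1.2).measurableSet

theorem lintegral_eq_iSup_stepSup {φ : E → ℝ≥0∞} (hφ : Continuous φ) (ν : Measure E) :
    ∫⁻ x, φ x ∂ν =
      ⨆ F : {F : Finset (TopologicalSpace.countableBasis E × ℚ) // ∀ y, stepSup F y ≤ φ y},
        ∫⁻ x, stepSup F.1 x ∂ν := by
  have : Countable (TopologicalSpace.countableBasis E) :=
    (TopologicalSpace.countable_countableBasis E).to_subtype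
  have hm : ∀ F : {F : Finset (TopologicalSpace.countableBasis E × ℚ) // ∀ y, stepSup F y ≤ φ y},
      AEMeasurable (stepSup F.1) ν := fun F => (measurable_stepSup F.1).aemeasurable
  have h := lintegral_iSup_directed hm (directed_stepSup φ)
  rw [← h]
  refine lintegral_congr fun x => ?_
  rw [iSup_stepSup_eq hφ x]

/-- Since `u = c - w`, lower semicontinuity of `w` makes `u` upper semicontinuous as well. -/
theorem continuous_of_lowerSemicontinuous_add {X : Type*} [TopologicalSpace X]
    {u w c : X → ℝ≥0∞} (hu : LowerSemicontinuous u) (hw : LowerSemicontinuous w)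
    (hc : Continuous c) (h : ∀ x, u x + w x = c x) (hfin : ∀ x, c x ≠ ∞) : Continuous u := by
  have hu' : ∀ x, u x ≠ ∞ := fun x => ne_top_of_le_ne_top (hfin x) (h x ▸ le_self_add)
  have hw' : ∀ x, w x ≠ ∞ := fun x => ne_top_of_le_ne_top (hfin x) (h x ▸ le_add_self)
  rw [continuous_iff_continuousAt]
  refine fun x₀ => tendsto_order.2 ⟨fun a ha => hu x₀ a ha, fun a ha => ?_⟩
  obtain ⟨ε, hε, hεa⟩ : ∃ ε : ℝ≥0∞, 0 < ε ∧ u x₀ + (ε + ε) ≤ a := by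
    refine ⟨(a - u x₀) / 2, ENNReal.half_pos (tsub_pos_of_lt ha).ne', ?_⟩
    rw [ENNReal.add_halves, add_tsub_cancel_of_le ha.le]
  have h1 : ∀ᶠ x in 𝓝 x₀, w x₀ < w x + ε := by
    have hl : LowerSemicontinuous fun x => w x + ε := hw.add lowerSemicontinuous_const
    exact hl x₀ (w x₀) (ENNReal.lt_add_right (hw' x₀) hε.ne')
  have h2 : ∀ᶠ x in 𝓝 x₀, c x < c x₀ + ε :=
    hc.continuousAt.eventually_lt_const (ENNReal.lt_add_right (hfin x₀) hε.ne')
  filter_upwards [h1, h2] with x h1 h2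
  refine lt_of_lt_of_le ?_ hεa
  rw [← h, ← h] at h2
  refine lt_of_add_lt_add_right (a := w x) (h2.trans_le ?_)
  calc u x₀ + w x₀ + ε ≤ u x₀ + (w x + ε) + ε := by gcongr
    _ = _ := by ring

theorem continuous_finiteMeasure_of_stepSup {X : Type*} [TopologicalSpace X]
    {s : X → FiniteMeasure E} (h1 : Continuous fun x => (s x : Measure E) univ)
    (h : ∀ F, Continuous fun x => ∫⁻ y, stepSup F y ∂(s x : Measure E)) : Continuous s := by
  rw [FiniteMeasure.continuous_iff_forall_continuous_lintegral]
  have hlsc : ∀ φ : E →ᵇ ℝ≥0, LowerSemicontinuous fun x => ∫⁻ y, φ y ∂(s x : Measure E) := by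
    intro φ
    have hφ : Continuous fun y => (φ y : ℝ≥0∞) := ENNReal.continuous_coe.comp φ.continuous
    simp_rw [lintegral_eq_iSup_stepSup hφ]
    exact lowerSemicontinuous_iSup fun F => (h F.1).lowerSemicontinuous
  intro φ
  obtain ⟨C, hC⟩ : ∃ C, ∀ x, φ x ≤ C := ⟨_, boundedNN_apply_le φ⟩
  have hcont : Continuous fun x => (C : ℝ≥0∞) * (s x : Measure E) univ :=
    (ENNReal.continuous_const_mul ENNReal.coe_ne_top).comp h1
  -- Integrals of `φ` and of `C - φ` are both suprema of continuous functions, and they add up to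
  -- `C` times the mass.
  refine continuous_of_lowerSemicontinuous_add (hlsc φ)
    (hlsc (BoundedContinuousFunction.const E C - φ)) hcont (fun x => ?_)
    fun x => ENNReal.mul_ne_top ENNReal.coe_ne_top (measure_ne_top _ _)
  rw [← lintegral_add_left (measurable_boundedNN φ).coe_nnreal_ennreal, ← lintegral_const]
  refine lintegral_congr fun y => ?_
  rw [← ENNReal.coe_add, BoundedContinuousFunction.coe_sub, Pi.sub_apply,
    BoundedContinuousFunction.const_apply, add_tsub_cancel_of_le (hC y)]

/-- The mass and the countably many step integrals induce a topology at least as fine as the weak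
one. Weakly open sets are therefore preimages of open sets in a countable product of copies of `[0,
∞]`, where open sets belong to the product `σ`-algebra. -/
theorem measurable_finiteMeasure_of_measurable_apply {Ω : Type*} [MeasurableSpace Ω]
    {s : Ω → FiniteMeasure E}
    (hs : ∀ A, MeasurableSet A → Measurable fun ω => (s ω : Measure E) A) : Measurable s := by
  have : Countable (TopologicalSpace.countableBasis E) :=
    (TopologicalSpace.countable_countableBasis E).to_subtype
  set Φ : FiniteMeasure E → ℝ≥0∞ × (Finset (TopologicalSpace.countableBasis E × ℚ) → ℝ≥0∞) :=
    fun ν => ((ν : Measure E) univ, fun F => ∫⁻ y, stepSup F y ∂(ν : Measure E))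
  have hms : Measurable fun ω => (s ω : Measure E) := Measure.measurable_of_measurable_coe _ hs
  have hΦ : Measurable (Φ ∘ s) :=
    (hs univ MeasurableSet.univ).prodMk (measurable_pi_lambda _ fun F =>
      (Measure.measurable_lintegral (measurable_stepSup F)).comp hms)
  have hid : Continuous[TopologicalSpace.induced Φ inferInstance, inferInstance]
      (id : FiniteMeasure E → FiniteMeasure E) := by
    let _ : TopologicalSpace (FiniteMeasure E) := TopologicalSpace.induced Φ inferInstance
    have hΦc : Continuous Φ := continuous_induced_dom
    refine continuous_finiteMeasure_of_stepSup (X := FiniteMeasure E) (s := id)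
      (continuous_fst.comp hΦc) fun F => ?_
    exact (continuous_apply F).comp (continuous_snd.comp hΦc)
  refine measurable_of_isOpen fun O hO => ?_
  obtain ⟨V, hV, hVO⟩ := isOpen_induced_iff.1 (continuous_def.1 hid O hO)
  have : s ⁻¹' O = (Φ ∘ s) ⁻¹' V := by
    rw [preimage_comp, hVO]; rfl
  rw [this]
  exact hΦ hV.measurableSet

end Borel

/-! ### Uniformly tight families -/

section Tight

variable {E : Type*} [TopologicalSpace E] [MeasurableSpace E] {ι : Type*}

/-- A family of measures that is bounded in mass and uniformly tight. -/
def UniformlyTight (ν : ι → Measure E) : Prop :=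
  (∃ C : ℝ≥0, ∀ α, ν α univ ≤ C) ∧
    ∀ ε : ℝ≥0, 0 < ε → ∃ K, IsCompact K ∧ ∀ α, ν α Kᶜ ≤ ε

theorem UniformlyTight.mono {ν ν' : ι → Measure E} (h : UniformlyTight ν')
    (hle : ∀ α, ν α ≤ ν' α) : UniformlyTight ν :=
  ⟨h.1.imp fun _ hC α => (hle α _).trans (hC α),
    fun ε hε => (h.2 ε hε).imp fun _ hK => ⟨hK.1, fun α => (hle α _).trans (hK.2 α)⟩⟩

theorem UniformlyTight.add {ν ν' : ι → Measure E} (h : UniformlyTight ν)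
    (h' : UniformlyTight ν') : UniformlyTight fun α => ν α + ν' α := by
  obtain ⟨⟨C, hC⟩, h⟩ := h
  obtain ⟨⟨C', hC'⟩, h'⟩ := h'
  refine ⟨⟨C + C', fun α => ?_⟩, fun ε hε => ?_⟩
  · rw [Measure.add_apply, ENNReal.coe_add]
    exact add_le_add (hC α) (hC' α)
  · obtain ⟨K, hK, h⟩ := h (ε / 2) (half_pos hε)
    obtain ⟨K', hK', h'⟩ := h' (ε / 2) (half_pos hε)
    refine ⟨K ∪ K', hK.union hK', fun α => ?_⟩
    rw [Measure.add_apply, ← add_halves ε, ENNReal.coe_add]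
    exact add_le_add ((measure_mono (compl_subset_compl.2 subset_union_left)).trans (h α))
      ((measure_mono (compl_subset_compl.2 subset_union_right)).trans (h' α))

theorem UniformlyTight.const_smul {ν : ι → Measure E} (h : UniformlyTight ν) (c : ℝ≥0) :
    UniformlyTight fun α => (c : ℝ≥0∞) • ν α := by
  obtain ⟨⟨C, hC⟩, h⟩ := h
  refine ⟨⟨c * C, fun α => ?_⟩, fun ε hε => ?_⟩
  · rw [Measure.smul_apply, smul_eq_mul, ENNReal.coe_mul]
    gcongr
    exact hC α
  · obtain ⟨K, hK, h⟩ := h (ε / (c + 1)) (by positivity)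
    refine ⟨K, hK, fun α => ?_⟩
    rw [Measure.smul_apply, smul_eq_mul]
    calc (c : ℝ≥0∞) * ν α Kᶜ ≤ ((c + 1 : ℝ≥0) : ℝ≥0∞) * (ε / (c + 1) : ℝ≥0) := by
          gcongr
          · simp
          · exact h α
      _ = ε := by
          rw [← ENNReal.coe_mul, mul_div_cancel₀]
          positivity

/-- Cut-offs `ψ n`, zero on `K n` and one off `K (n + 1)`, give weakly open sets `{∫ ψ n < ε}`.
These cover all finite measures because the tails of a single measure vanish, and compactness leaves
finitely many. -/
theorem uniformlyTight_of_isCompact_closure [T2Space E] [NormalSpace E] [LocallyCompactSpace E]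
    [SigmaCompactSpace E] [OpensMeasurableSpace E] {ν : ι → FiniteMeasure E}
    (h : IsCompact (closure (range ν))) : UniformlyTight fun α => (ν α : Measure E) := by
  refine ⟨?_, fun ε hε => ?_⟩
  · obtain ⟨C, hC⟩ := (h.image FiniteMeasure.continuous_mass).bddAbove
    refine ⟨C, fun α => ?_⟩
    rw [← FiniteMeasure.ennreal_mass]
    exact ENNReal.coe_le_coe.2 (hC ⟨ν α, subset_closure (mem_range_self α), rfl⟩)
  · set K := CompactExhaustion.choice E
    have hψ : ∀ n, ∃ ψ : E →ᵇ ℝ≥0, (∀ x ∈ K n, ψ x = 0) ∧ (∀ x ∉ K (n + 1), ψ x = 1) ∧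
        ∀ x, ψ x ≤ 1 := by
      intro n
      obtain ⟨g, hg0, hg1, hg⟩ := exists_continuous_zero_one_of_isClosed (K.isCompact n).isClosed
        (isOpen_interior (s := K (n + 1))).isClosed_compl
        (disjoint_compl_right_iff_subset.2 (K.subset_interior_succ n))
      refine ⟨BoundedContinuousFunction.mkOfBound
        ⟨fun x => Real.toNNReal (g x), continuous_real_toNNReal.comp g.continuous⟩ 1 fun x y => ?_,
        fun x hx => ?_, fun x hx => ?_, fun x => ?_⟩
      · have h1 := hg x
        have h2 := hg y
        simp only [ContinuousMap.coe_mk, NNReal.dist_eq, Real.coe_toNNReal _ h1.1,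
          Real.coe_toNNReal _ h2.1]
        rw [abs_le]
        constructor <;> linarith [h1.1, h1.2, h2.1, h2.2]
      · simp [hg0 hx]
      · simp [hg1 (show x ∈ (interior (K (n + 1)))ᶜ from fun h => hx (interior_subset h))]
      · simpa using (hg x).2
    choose ψ hψ0 hψ1 hψle using hψ
    set O : ℕ → Set (FiniteMeasure E) := fun n => {ρ | ∫⁻ x, ψ n x ∂(ρ : Measure E) < ε}
    have hO : ∀ n, IsOpen (O n) := fun n => isOpen_lt (by fun_prop) continuous_const
    have hcov : closure (range ν) ⊆ ⋃ n, O n := by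
      intro ρ _
      have hanti : Antitone fun n => (K n : Set E)ᶜ := fun _ _ h => compl_subset_compl.2 (K.subset h)
      have hlim := tendsto_measure_iInter_atTop (μ := (ρ : Measure E)) (s := fun n => (K n : Set E)ᶜ)
        (fun n => (K.isCompact n).isClosed.measurableSet.compl.nullMeasurableSet) hanti
        ⟨0, measure_ne_top _ _⟩
      rw [← compl_iUnion, K.iUnion_eq, compl_univ, measure_empty] at hlim
      obtain ⟨n, hn⟩ := (hlim.eventually_lt_const (ENNReal.coe_pos.2 hε)).exists
      refine mem_iUnion.2 ⟨n, lt_of_le_of_lt ?_ hn⟩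
      rw [Function.comp_apply,
        ← lintegral_indicator_one (K.isCompact n).isClosed.measurableSet.compl]
      refine lintegral_mono fun x => ?_
      by_cases hx : x ∈ K n
      · simp [hψ0 n x hx]
      · simpa [hx] using hψle n x
    obtain ⟨t, ht⟩ := h.elim_finite_subcover O hO hcov
    -- The shift by one is needed because `ψ n` equals one only off `K (n + 1)`.
    refine ⟨K (t.sup id + 1), K.isCompact _, fun α => ?_⟩
    obtain ⟨n, hn, hνn⟩ := mem_iUnion₂.1 (ht (subset_closure (mem_range_self α)))
    refine le_trans ?_ (le_of_lt hνn)
    rw [← lintegral_indicator_one (K.isCompact _).isClosed.measurableSet.compl]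
    refine lintegral_mono fun x => ?_
    by_cases hx : x ∈ K (t.sup id + 1)
    · simp [hx]
    · have hx' : x ∉ K (n + 1) := fun h' => hx (K.subset
        (Nat.succ_le_succ (Finset.le_sup (f := id) hn)) h')
      simp [hx, hψ1 n x hx']

/-- Domination of the mean measures by a uniformly tight family makes the laws of the random
measures tight, by Markov's inequality; Prokhorov's theorem is used both on `E` and on the space of
finite measures. -/
theorem isCompact_closure_range_map [T2Space E] [NormalSpace E] [HasOuterApproxClosed E]
    [BorelSpace E] {Ω : Type*} [MeasurableSpace Ω] {P : ι → ProbabilityMeasure Ω}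
    {s : Ω → FiniteMeasure E} (hs : Measurable s)
    (hsA : ∀ A, MeasurableSet A → Measurable fun ω => (s ω : Measure E) A)
    {ν : ι → Measure E} (hν : UniformlyTight ν)
    (hle : ∀ α A, MeasurableSet A →
      ∫⁻ ω, (s ω : Measure E) A ∂(P α : Measure Ω) ≤ ν α A) :
    IsCompact (closure (range fun α => (P α).toFiniteMeasure.map s)) := by
  have htight : IsTightMeasureSet {((Q : ProbabilityMeasure (FiniteMeasure E)) :
      Measure (FiniteMeasure E)) | Q ∈ range fun α => (P α).map (hs.aemeasurable)} := by
    rw [isTightMeasureSet_iff_exists_isCompact_measure_compl_le]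
    intro ε hε
    obtain ⟨⟨C, hC⟩, hν⟩ := hν
    obtain ⟨ε', hε', hsum⟩ := ENNReal.exists_pos_sum_of_countable hε.ne' ℕ
    -- The budget is split: `ε' 0` for large total mass, `ε' (n + 1)` for excess mass outside `K n`.
    rw [tsum_eq_zero_add' ENNReal.summable] at hsum
    set u : ℕ → ℝ≥0 := fun n => 1 / ((n : ℝ≥0) + 1)
    have hu0 : ∀ n, 0 < u n := fun n => by positivity
    have hu : Tendsto u atTop (𝓝 0) := by
      rw [← NNReal.tendsto_coe]
      simpa [u] using tendsto_one_div_add_atTop_nhds_zero_nat (𝕜 := ℝ)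
    choose K hK hKν using fun n => hν (u n * ε' (n + 1)) (mul_pos (hu0 n) (hε' _))
    -- Markov's inequality needs `C ≤ R ε' 0`; the added one keeps `R` positive when `C = 0`.
    set R : ℝ≥0 := (C + 1) / ε' 0 with hR
    have hR0 : 0 < R := div_pos (by positivity) (hε' _)
    set 𝒦 : Set (FiniteMeasure E) := {ρ | ρ.mass ≤ R ∧ ∀ n, ρ (K n)ᶜ ≤ u n}
    have h𝒦 : IsCompact 𝒦 := isCompact_setOfPred_finiteMeasure_mass_le_compl_isCompact_le R hu hK
      (Or.inl inferInstance)
    refine ⟨𝒦, h𝒦, ?_⟩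
    rintro _ ⟨_, ⟨α, rfl⟩, rfl⟩
    have hmk : ∀ (A : Set E) (hA : MeasurableSet A) (r b : ℝ≥0), 0 < r → ν α A ≤ r * b →
        (P α : Measure Ω) {ω | (r : ℝ≥0∞) ≤ (s ω : Measure E) A} ≤ b := by
      intro A hA r b hr hb
      refine (meas_ge_le_lintegral_div (hsA A hA).aemeasurable (ENNReal.coe_ne_zero.2 hr.ne')
        ENNReal.coe_ne_top).trans ?_
      refine ENNReal.div_le_of_le_mul ?_
      rw [mul_comm]
      exact (hle α A hA).trans hb
    have hsub : s ⁻¹' 𝒦ᶜ ⊆ {ω | (R : ℝ≥0∞) ≤ (s ω : Measure E) univ} ∪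
        ⋃ n, {ω | (u n : ℝ≥0∞) ≤ (s ω : Measure E) (K n)ᶜ} := by
      intro ω hω
      by_contra hcon
      simp only [mem_union, mem_iUnion, mem_ofPred_eq, not_or, not_exists, not_le] at hcon
      refine hω ⟨?_, fun n => ?_⟩
      · rw [← ENNReal.coe_le_coe, FiniteMeasure.ennreal_mass]
        exact hcon.1.le
      · rw [← ENNReal.coe_le_coe, FiniteMeasure.ennreal_coeFn_eq_coeFn_toMeasure]
        exact (hcon.2 n).le
    change ((P α).map hs.aemeasurable : Measure (FiniteMeasure E)) 𝒦ᶜ ≤ ε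
    rw [ProbabilityMeasure.toMeasure_map, Measure.map_apply hs h𝒦.isClosed.measurableSet.compl]
    calc _ ≤ _ := measure_mono hsub
      _ ≤ _ := measure_union_le _ _
      _ ≤ ε' 0 + ∑' n, (ε' (n + 1) : ℝ≥0∞) := by
          refine add_le_add (hmk univ MeasurableSet.univ R _ hR0 ?_)
            ((measure_iUnion_le _).trans (ENNReal.tsum_le_tsum fun n => ?_))
          · refine (hC α).trans ?_
            rw [← ENNReal.coe_mul, hR, div_mul_cancel₀ _ (hε' 0).ne']
            simp
          · refine hmk _ (hK n).isClosed.measurableSet.compl _ _ (hu0 n) ?_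
            exact_mod_cast hKν n α
      _ ≤ ε := hsum.le
  have hcomp := (isCompact_closure_of_isTightMeasureSet htight).image
    (ProbabilityMeasure.toFiniteMeasure_isEmbedding _).continuous
  refine hcomp.closure_of_subset ?_
  rintro _ ⟨α, rfl⟩
  exact ⟨_, subset_closure (mem_range_self α), rfl⟩

end Tight

/-! ### The map `σ_f` -/

section Sigma

variable {E : Type*} [TopologicalSpace E] [MeasurableSpace E]

theorem mem_confSummable_iff {f : E → ℝ≥0} (hf : Measurable f) (X : Conf E) :
    X ∈ confSummable f ↔ ∫⁻ x, f x ∂confMeasure X < ∞ := by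
  rw [lintegral_confMeasure X hf.coe_nnreal_ennreal]
  rfl

theorem coe_sigmaMap_of_mem {f : E → ℝ≥0} {X : Conf E} (hX : X ∈ confSummable f) :
    (sigmaMap f X : Measure E) =
      Measure.sum fun x => ((X.mult x : ℝ≥0∞) * (f x : ℝ≥0∞)) • Measure.dirac x :=
  congrArg FiniteMeasure.toMeasure (dif_pos hX)

theorem sigmaMap_apply_of_mem {f : E → ℝ≥0} (hf : Measurable f) {X : Conf E}
    (hX : X ∈ confSummable f) {A : Set E} (hA : MeasurableSet A) :
    (sigmaMap f X : Measure E) A = ∫⁻ x in A, f x ∂confMeasure X := by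
  rw [coe_sigmaMap_of_mem hX, Measure.sum_apply _ hA,
    ← lintegral_indicator hA, lintegral_confMeasure X (hf.coe_nnreal_ennreal.indicator hA)]
  refine tsum_congr fun x => ?_
  by_cases h : x ∈ A <;> simp [hA, h]

theorem sigmaMap_of_notMem {f : E → ℝ≥0} {X : Conf E} (hX : X ∉ confSummable f) :
    sigmaMap f X = 0 :=
  dif_neg hX

/-- The default value zero off the domain preserves the bound, so expectations can be estimated
without removing an exceptional set. -/
theorem sigmaMap_apply_le {f : E → ℝ≥0} (hf : Measurable f) (X : Conf E) {A : Set E}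
    (hA : MeasurableSet A) :
    (sigmaMap f X : Measure E) A ≤ ∫⁻ x in A, f x ∂confMeasure X := by
  by_cases hX : X ∈ confSummable f
  · exact (sigmaMap_apply_of_mem hf hX hA).le
  · simp [sigmaMap_of_notMem hX]

variable [T2Space E] [SigmaCompactSpace E] [OpensMeasurableSpace E]

theorem measurable_sigmaMap_apply {f : E → ℝ≥0} (hf : Measurable f) {A : Set E}
    (hA : MeasurableSet A) : Measurable fun X => (sigmaMap f X : Measure E) A := by
  classical
  have h1 : ∀ h : E → ℝ≥0∞, Measurable h → Measurable fun X => ∫⁻ x, h x ∂confMeasure X :=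
    fun h hh => (Measure.measurable_lintegral hh).comp measurable_confMeasure
  have hms : MeasurableSet (confSummable f) := by
    have : confSummable f = {X | ∫⁻ x, f x ∂confMeasure X < ∞} :=
      Set.ext fun X => mem_confSummable_iff hf X
    rw [this]
    exact measurableSet_lt (h1 _ hf.coe_nnreal_ennreal) measurable_const
  have h2 : (fun X => (sigmaMap f X : Measure E) A) =
      (confSummable f).indicator fun X => ∫⁻ x, A.indicator (fun x => (f x : ℝ≥0∞)) x
        ∂confMeasure X := by
    ext X
    by_cases hX : X ∈ confSummable f
    · rw [indicator_of_mem hX, sigmaMap_apply_of_mem hf hX hA, lintegral_indicator hA]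
    · rw [indicator_of_notMem hX, sigmaMap_of_notMem hX]
      simp
  rw [h2]
  exact (h1 _ (hf.coe_nnreal_ennreal.indicator hA)).indicator hms

end Sigma

/-! ### Precompactness of the pushforwards -/

section Main

variable {E : Type*} [MetricSpace E] [MeasurableSpace E] [BorelSpace E] {μ : Measure E}
  {ι : Type*}

theorem locallyTraceClass_and_uniformlyTight_sup_span_singleton (f : E →ᵇ ℝ≥0)
    {M : ι → Submodule ℂ (L2 μ)}
    (hloc : ∀ α, LocallyTraceClass μ (orthProj (M α)))
    (ht : UniformlyTight fun α => (traceMeasure (M α)).withDensity fun x => (f x : ℝ≥0∞))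
    {v : ι → L2 μ} (hvt : UniformlyTight fun α => (densityMeasure μ f (v α) : Measure E))
    (C : ℝ≥0) (hC : ∀ α, 1 ≤ C * ‖v α - orthProj (M α) (v α)‖ ^ 2)
    (hv : ∀ α, ‖orthProj (M α) (v α)‖ ≤ 1) :
    (∀ α, LocallyTraceClass μ (orthProj (M α ⊔ Submodule.span ℂ {v α}))) ∧
      UniformlyTight fun α => (traceMeasure (M α ⊔ Submodule.span ℂ {v α})).withDensity
        fun x => (f x : ℝ≥0∞) := by
  have hle := fun α => traceMeasure_sup_span_singleton_le (M α) (v α) C (hC α) (hv α)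
  refine ⟨fun α => (locallyTraceClass_orthProj_iff _).2 fun B hB => ?_, ?_⟩
  · refine (hle α B).trans_lt ?_
    simp only [Measure.coe_add, Measure.coe_smul, Pi.add_apply, Pi.smul_apply, smul_eq_mul]
    refine ENNReal.add_lt_top.2 ⟨ENNReal.mul_lt_top ENNReal.coe_lt_top
      ((locallyTraceClass_orthProj_iff _).1 (hloc α) B hB),
      ENNReal.mul_lt_top ENNReal.coe_lt_top ?_⟩
    rw [withDensity_apply _ hB.1]
    refine (setLIntegral_le_lintegral _ _).trans_lt ?_
    rw [← L2.enorm_sq_eq_lintegral]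
    exact ENNReal.pow_lt_top enorm_lt_top
  · refine ((ht.const_smul (1 + 2 * C)).add (hvt.const_smul (2 * C))).mono fun α => ?_
    have hd : (densityMeasure μ f (v α) : Measure E) =
        (μ.withDensity fun x => ‖v α x‖ₑ ^ 2).withDensity fun x => (f x : ℝ≥0∞) := by
      rw [← withDensity_mul _ (by fun_prop) (measurable_boundedNN f).coe_nnreal_ennreal, mul_comm]
      rfl
    rw [hd, ← withDensity_smul_measure, ← withDensity_smul_measure, ← withDensity_add_measure]
    refine Measure.le_iff.2 fun A hA => ?_
    rw [withDensity_apply _ hA, withDensity_apply _ hA]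
    exact lintegral_mono' (Measure.restrict_mono le_rfl (hle α)) le_rfl

theorem uniformlyTight_withDensity_traceMeasure (f : E →ᵇ ℝ≥0) {L : ι → Submodule ℂ (L2 μ)}
    (hsup : ⨆ α, posTrace (sqrtOp μ f * orthProj (L α) * sqrtOp μ f) < ∞)
    (htight : ∀ ε : ℝ≥0, 0 < ε → ∃ B : Set E, BoundedBorel B ∧
      ⨆ α, posTrace (indOp μ Bᶜ * sqrtOp μ f * orthProj (L α) * sqrtOp μ f * indOp μ Bᶜ) < ε) :
    UniformlyTight fun α => (traceMeasure (L α)).withDensity fun x => (f x : ℝ≥0∞) := by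
  refine ⟨⟨(⨆ α, posTrace (sqrtOp μ f * orthProj (L α) * sqrtOp μ f)).toNNReal, fun α => ?_⟩,
    fun ε hε => ?_⟩
  · rw [ENNReal.coe_toNNReal hsup.ne, withDensity_apply _ MeasurableSet.univ,
      Measure.restrict_univ, ← posTrace_sqrtOp]
    exact le_iSup (fun α => posTrace (sqrtOp μ f * orthProj (L α) * sqrtOp μ f)) α
  · obtain ⟨B, hB, h⟩ := htight ε hε
    refine ⟨closure B, hB.2, fun α => ?_⟩
    refine (measure_mono (compl_subset_compl.2 subset_closure)).trans ?_
    rw [withDensity_apply _ hB.1.compl, ← posTrace_indOp_sqrtOp f _ hB.1.compl]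
    exact (le_iSup (fun α => posTrace (indOp μ Bᶜ * sqrtOp μ f * orthProj (L α) * sqrtOp μ f *
      indOp μ Bᶜ)) α).trans h.le

theorem locallyTraceClass_and_uniformlyTight_sup_span_range (f : E →ᵇ ℝ≥0)
    {L : ι → Submodule ℂ (L2 μ)} (hL : ∀ α, IsClosed (L α : Set (L2 μ)))
    (hloc : ∀ α, LocallyTraceClass μ (orthProj (L α)))
    (ht : UniformlyTight fun α => (traceMeasure (L α)).withDensity fun x => (f x : ℝ≥0∞))
    {m : ℕ} {v : ι → Fin m → L2 μ} (hv : ∀ α k, ‖v α k‖ = 1)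
    (hvt : UniformlyTight fun p : ι × Fin m => (densityMeasure μ f (v p.1 p.2) : Measure E))
    {δ : ℝ} (hδ : 0 < δ)
    (hangle : ∀ α k, δ ≤ vectorAngle (v α k) (L α ⊔ Submodule.span ℂ (v α '' {j | j < k})))
    (k : ℕ) (hk : k ≤ m) :
    (∀ α, LocallyTraceClass μ
        (orthProj (L α ⊔ Submodule.span ℂ (v α '' {j | (j : ℕ) < k})))) ∧
      UniformlyTight fun α => (traceMeasure (L α ⊔ Submodule.span ℂ
        (v α '' {j | (j : ℕ) < k}))).withDensity fun x => (f x : ℝ≥0∞) := by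
  induction k with
  | zero => simpa using ⟨hloc, ht⟩
  | succ k ih =>
    obtain ⟨ih1, ih2⟩ := ih (by omega)
    set κ : Fin m := ⟨k, hk⟩
    have hins : {j : Fin m | (j : ℕ) < k + 1} = insert κ {j : Fin m | (j : ℕ) < k} := by
      ext j
      simp only [mem_ofPred_eq, mem_insert_iff, Fin.ext_iff, κ]
      omega
    have hspan : ∀ α, L α ⊔ Submodule.span ℂ (v α '' {j | (j : ℕ) < k + 1}) =
        (L α ⊔ Submodule.span ℂ (v α '' {j | (j : ℕ) < k})) ⊔ Submodule.span ℂ {v α κ} := by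
      intro α
      rw [hins, image_insert_eq, Submodule.span_insert, sup_assoc]
      congr 1
      exact sup_comm _ _
    simp_rw [hspan]
    -- Closedness puts the projection of `v α κ` inside the subspace over which the angle is
    -- minimized.
    have hc := fun α => one_sub_cos_sq_le_norm_sub_orthProj_sq
      (isClosed_sup_span (L α) (hL α) ((toFinite {j : Fin m | (j : ℕ) < k}).image (v α)))
      (hv α κ) hδ (hangle α κ)
    refine locallyTraceClass_and_uniformlyTight_sup_span_singleton f ih1 ih2
      ⟨hvt.1.imp fun _ h α => h (α, κ), fun ε hε => (hvt.2 ε hε).imp fun _ h =>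
        ⟨h.1, fun α => h.2 (α, κ)⟩⟩ (Real.toNNReal (1 - Real.cos δ ^ 2)⁻¹) (fun α => ?_)
      fun α => ?_
    · obtain ⟨h0, h1⟩ := hc α
      rw [Real.coe_toNNReal _ (by positivity)]
      rwa [inv_mul_eq_div, one_le_div h0]
    · rw [← hv α κ]
      exact Submodule.norm_starProjection_apply_le _ _

variable [LocallyCompactSpace E] [SecondCountableTopology E]

/-- The mean of `σ_f(X)(A)` is at most the integral of `f` over `A` against the trace measure. For
`A = E` finiteness gives almost sure summability; uniform tightness gives precompactness. -/
theorem pushforwardsPrecompact_of_uniformlyTight (f : E →ᵇ ℝ≥0) (M : ι → Submodule ℂ (L2 μ))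
    (hloc : ∀ α, LocallyTraceClass μ (orthProj (M α)))
    (ht : UniformlyTight fun α => (traceMeasure (M α)).withDensity fun x => (f x : ℝ≥0∞)) :
    PushforwardsPrecompact μ f fun α => orthProj (M α) := by
  refine ⟨hloc, fun P hP => ?_⟩
  have hf := measurable_boundedNN f
  have hmA := fun A (hA : MeasurableSet A) => measurable_sigmaMap_apply hf hA
  have hm : Measurable (sigmaMap f) := measurable_finiteMeasure_of_measurable_apply hmA
  refine ⟨fun α => ?_, fun α => hm.aemeasurable,
    isCompact_closure_range_map hm hmA ht fun α A hA => ?_⟩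
  · obtain ⟨C, hC⟩ := ht.1
    have h1 := lintegral_lintegral_confMeasure_le (hP α) hf.coe_nnreal_ennreal
    have h2 := hC α
    rw [withDensity_apply _ MeasurableSet.univ, Measure.restrict_univ] at h2
    have h3 := ae_lt_top ((Measure.measurable_lintegral hf.coe_nnreal_ennreal).comp
      measurable_confMeasure) ((h1.trans h2).trans_lt ENNReal.coe_lt_top).ne
    filter_upwards [h3] with X hX
    exact (mem_confSummable_iff hf X).2 hX
  · rw [withDensity_apply _ hA, ← lintegral_indicator hA]
    refine le_trans (lintegral_mono fun X => ?_)
      (lintegral_lintegral_confMeasure_le (hP α) (hf.coe_nnreal_ennreal.indicator hA))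
    rw [lintegral_indicator hA]
    exact sigmaMap_apply_le hf X hA

end Main

theorem proposition3p10 {E : Type*} [MetricSpace E] [CompleteSpace E] [LocallyCompactSpace E]
    [SecondCountableTopology E] [MeasurableSpace E] [BorelSpace E]
    (μ : Measure E) [SigmaFinite μ] (f : E →ᵇ ℝ≥0) {ι : Type*}
    -- the projections `Π_α`, with ranges `L α`
    (L : ι → Submodule ℂ (L2 μ)) (hL : ∀ α, IsClosed (L α : Set (L2 μ)))
    (hloc : ∀ α, LocallyTraceClass μ (orthProj (L α)))
    (hsup : ⨆ α, posTrace (sqrtOp μ f * orthProj (L α) * sqrtOp μ f) < ∞)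
    (htight : ∀ ε : ℝ≥0, 0 < ε → ∃ B : Set E, BoundedBorel B ∧
      ⨆ α, posTrace (indOp μ Bᶜ * sqrtOp μ f * orthProj (L α) * sqrtOp μ f * indOp μ Bᶜ) < ε) :
    -- perturbations of rank one by vectors orthogonal to `L α`
    (∀ v : ι → L2 μ,
      (∀ α, v α ∈ (L α)ᗮ) →
      (∃ c : ℝ, 0 < c ∧ ∀ α, c ≤ ‖v α‖) →
      IsCompact (closure (range fun α => densityMeasure μ f (v α))) →
      PushforwardsPrecompact μ f fun α => orthProj (L α ⊔ Submodule.span ℂ {v α})) ∧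
    -- perturbations of rank `m`
    (∀ (m : ℕ) (v : ι → Fin m → L2 μ),
      (∀ α k, ‖v α k‖ = 1) →
      IsCompact (closure (range fun p : ι × Fin m => densityMeasure μ f (v p.1 p.2))) →
      (∃ δ : ℝ, 0 < δ ∧ ∀ α k,
        δ ≤ vectorAngle (v α k) (L α ⊔ Submodule.span ℂ (v α '' {j | j < k}))) →
      PushforwardsPrecompact μ f fun α => orthProj (L α ⊔ Submodule.span ℂ (range (v α)))) := by

  have ht := uniformlyTight_withDensity_traceMeasure f hsup htight
  refine ⟨fun v hvL ⟨c, hc, hcv⟩ hcomp => ?_, fun m v hv hcomp ⟨δ, hδ, hangle⟩ => ?_⟩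
  · have h0 : ∀ α, orthProj (L α) (v α) = 0 := fun α => by
      refine (Submodule.starProjection_apply_eq_zero_iff _).2 ?_
      rw [Submodule.orthogonal_closure]
      exact hvL α
    obtain ⟨h1, h2⟩ := locallyTraceClass_and_uniformlyTight_sup_span_singleton f hloc ht
      (uniformlyTight_of_isCompact_closure hcomp) (Real.toNNReal (c ^ 2)⁻¹) (fun α => by
        rw [h0, sub_zero, Real.coe_toNNReal _ (by positivity), inv_mul_eq_div,
          one_le_div (by positivity)]
        exact pow_le_pow_left₀ hc.le (hcv α) 2) fun α => by rw [h0, norm_zero]; exact zero_le_one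
    exact pushforwardsPrecompact_of_uniformlyTight f _ h1 h2
  · have huniv : {j : Fin m | (j : ℕ) < m} = univ := Set.ext fun j => by simp
    have h := locallyTraceClass_and_uniformlyTight_sup_span_range f hL hloc ht hv
      (uniformlyTight_of_isCompact_closure hcomp) hδ hangle m le_rfl
    simp only [huniv, image_univ] at h
    exact pushforwardsPrecompact_of_uniformlyTight f _ h.1 h.2
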